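/- Let $\mathbb{F}_4$ be the finite field with four elements, with conjugation $\overline{x}=x^2$ and Hermitian inner product $\langle x,y\rangle_H=\sum_i x_i\overline{y_i}$ on $\mathbb{F}_4^n$. A quaternary $[n,k,d]$ code is a $k$-dimensional subspace $C$ of $\mathbb{F}_4^n$ whose minimum non-zero (Hamming) weight is $d$. Its Hermitian dual is $C^\perp=\{x\in\mathbb{F}_4^n : \langle x,y\rangle_H=0 \text{ for all } y\in C\}$, and its dual distance $d^\perp$ is the minimum weight of $C^\perp$. The code $C$ is Hermitian LCD if $C\cap C^\perp=\{0\}$. Two codes $C,C'$ of length $n$ are equivalent if $C'=\{xP : x\in C\}$ for some $n\times n$ monomial matrix $P$ over $\mathbb{F}_4$. Let $d_4(n,k)$ be the largest minimum weight among all quaternary Hermitian LCD $[n,k]$ codes. For $n=\frac{4^k-1}{3}s+t$ with $0\le t<\frac{4^k-1}{3}$, put $$r_{n,k,d}=4^{k-1}n-\frac{4^k-1}{3}\,d,\qquad s'_{n,k,d}=\frac{4r_{n,k,d}-t}{(4^k-1)/3}+1 .$$ For $t\in\{0,1,\dots,20\}$ let $\alpha(t)$, $s'(t)$, $r(t)$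 be given by the following table. $$\begin{array}{c|ccccccccccccccccccccc} t&0&1&2&3&4&5&6&7&8&9&10&11&12&13&14&15&16&17&18&19&20\\ \hline \alpha(t)&-1&-1&0&1&2&3&3&4&5&6&6&7&8&9&9&10&11&12&13&13&14\\ s'(t)&5&8&7&6&5&4&7&6&5&4&7&6&5&4&7&6&5&4&3&6&5\\ r(t)&21&37&32&27&22&17&33&28&23&18&34&29&24&19&35&30&25&20&15&31&26 \end{array}$$ **Proposition.** Let $t\in\{0,1,\dots,20\}$, let $s$ be an integer with $s\ge s'(t)$, and put $n=21s+t$. Then $d_4(n,3)=16s+\alpha(t)$, $r_{n,3,d_4(n,3)}=r(t)$ and $s'_{n,3,d_4(n,3)}=s'(t)$, and there is a one-to-one correspondence between the equivalence classes of quaternary Hermitian LCD $[4r(t),3,3r(t)]$ codes with dual distance $d^\perp\ge 2$ and the equivalence classes of quaternary Hermitian LCD $[21s+t,3,d_4(21s+t,3)]$ codes with dual distance $d^\perp\ge 2$. -/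

import Mathlib

namespace QuaternaryLCD

section Codes

/-- The Hermitian inner product `⟨x, y⟩_H = ∑ xᵢ ȳᵢ` on `Fⁿ`, where `F` is a field with four
elements, so that conjugation is `ȳ = y ^ 2`. -/
def hermInner {F : Type*} [Field F] {n : ℕ} (x y : Fin n → F) : F :=
  ∑ i, x i * (y i) ^ 2

/-- The Hermitian dual code `C^⊥ = {x | ⟨x, y⟩_H = 0 for all y ∈ C}`. -/
def hermDual {F : Type*} [Field F] {n : ℕ} (C : Submodule F (Fin n → F)) :
    Submodule F (Fin n → F) where
  carrier := {x | ∀ y ∈ C, hermInner x y = 0}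
  zero_mem' := by
    intro y _
    simp [hermInner]
  add_mem' := by
    intro a b ha hb y hy
    have h1 := ha y hy
    have h2 := hb y hy
    simp only [hermInner] at h1 h2 ⊢
    simp [add_mul, Finset.sum_add_distrib, h1, h2]
  smul_mem' := by
    intro c a ha y hy
    have h1 := ha y hy
    simp only [hermInner] at h1 ⊢
    simp [mul_assoc, ← Finset.mul_sum, h1]

/-- `C` is Hermitian linear complementary dual: `C ∩ C^⊥ = {0}`. -/
def IsHermitianLCD {F : Type*} [Field F] {n : ℕ} (C : Submodule F (Fin n → F)) : Prop :=
  C ⊓ hermDual C = ⊥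

/-- The set of weights (numbers of non-zero components) of the non-zero codewords of `C`. -/
def nonzeroWeights {F : Type*} [Field F] [DecidableEq F] {n : ℕ}
    (C : Submodule F (Fin n → F)) : Set ℕ :=
  {w | ∃ x ∈ C, x ≠ 0 ∧ hammingNorm x = w}

/-- `C` is an `[n, k, d]` code: a `k`-dimensional subspace of `Fⁿ` with minimum weight `d`. -/
def IsCode {F : Type*} [Field F] [DecidableEq F] {n : ℕ}
    (C : Submodule F (Fin n → F)) (k d : ℕ) : Prop :=
  Module.finrank F C = k ∧ IsLeast (nonzeroWeights C) d

/-- The dual distance `d^⊥` of `C` (the minimum weight of `C^⊥`) is at least `2`. -/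
def DualDistanceGeTwo {F : Type*} [Field F] [DecidableEq F] {n : ℕ}
    (C : Submodule F (Fin n → F)) : Prop :=
  ∀ w ∈ nonzeroWeights (hermDual C), 2 ≤ w

/-- `d₄(n, k)`: the largest minimum weight among all Hermitian LCD `[n, k]` codes. -/
noncomputable def largestMinWeight (F : Type*) [Field F] [DecidableEq F] (n k : ℕ) : ℕ :=
  sSup {d : ℕ | ∃ C : Submodule F (Fin n → F), IsCode C k d ∧ IsHermitianLCD C}

/-- A monomial matrix: an invertible diagonal matrix times a permutation matrix. -/
def IsMonomial {F : Type*} [Field F] {n : ℕ} (P : Matrix (Fin n) (Fin n) F) : Prop :=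
  ∃ (a : Fin n → Fˣ) (σ : Equiv.Perm (Fin n)),
    P = Matrix.diagonal (fun i => (a i : F)) * σ.permMatrix F

/-- Equivalence of codes: `C' = {x P | x ∈ C}` for some monomial matrix `P`. -/
def CodeEquiv {F : Type*} [Field F] {n : ℕ} (C C' : Submodule F (Fin n → F)) : Prop :=
  ∃ P : Matrix (Fin n) (Fin n) F, IsMonomial P ∧ C' = C.map P.vecMulLinear

theorem vecMul_diagonal_permMatrix {F : Type*} [Field F] {n : ℕ}
    (a : Fin n → Fˣ) (σ : Equiv.Perm (Fin n)) (x : Fin n → F) (j : Fin n) :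
    Matrix.vecMul x (Matrix.diagonal (fun i => (a i : F)) * σ.permMatrix F) j
      = x (σ.symm j) * a (σ.symm j) := by
  rw [← Matrix.vecMul_vecMul, Matrix.vecMul_permMatrix]
  simp [Matrix.vecMul_diagonal]

theorem codeEquiv_iff {F : Type*} [Field F] {n : ℕ} (C C' : Submodule F (Fin n → F)) :
    CodeEquiv C C' ↔ ∃ (a : Fin n → Fˣ) (σ : Equiv.Perm (Fin n)),
      ∀ y, y ∈ C' ↔ ∃ x ∈ C, ∀ j, x (σ.symm j) * a (σ.symm j) = y j := by
  constructor
  · rintro ⟨P, ⟨a, σ, rfl⟩, rfl⟩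
    refine ⟨a, σ, fun y => ?_⟩
    simp only [Submodule.mem_map, Matrix.vecMulLinear_apply, funext_iff,
      vecMul_diagonal_permMatrix]
  · rintro ⟨a, σ, h⟩
    refine ⟨_, ⟨a, σ, rfl⟩, ?_⟩
    ext y
    rw [h y]
    simp only [Submodule.mem_map, Matrix.vecMulLinear_apply, funext_iff,
      vecMul_diagonal_permMatrix]

theorem codeEquiv_refl {F : Type*} [Field F] {n : ℕ} (C : Submodule F (Fin n → F)) :
    CodeEquiv C C := by
  rw [codeEquiv_iff]
  refine ⟨1, Equiv.refl _, fun y => ⟨fun hy => ⟨y, hy, fun j => by simp⟩, ?_⟩⟩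
  rintro ⟨x, hx, h⟩
  have : x = y := funext fun j => by simpa using h j
  exact this ▸ hx

theorem codeEquiv_symm {F : Type*} [Field F] {n : ℕ} {C C' : Submodule F (Fin n → F)}
    (h : CodeEquiv C C') : CodeEquiv C' C := by
  rw [codeEquiv_iff] at h ⊢
  obtain ⟨a, σ, h⟩ := h
  refine ⟨fun i => (a (σ.symm i))⁻¹, σ.symm, fun y => ⟨fun hy => ?_, ?_⟩⟩
  · refine ⟨fun j => y (σ.symm j) * a (σ.symm j), (h _).2 ⟨y, hy, fun j => rfl⟩, fun j => ?_⟩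
    simp
  · rintro ⟨x, hx, hxy⟩
    obtain ⟨z, hz, hzx⟩ := (h x).1 hx
    have : z = y := funext fun j => by
      rw [← hxy j, ← hzx]
      simp
    exact this ▸ hz

theorem codeEquiv_trans {F : Type*} [Field F] {n : ℕ} {C C' C'' : Submodule F (Fin n → F)}
    (h : CodeEquiv C C') (h' : CodeEquiv C' C'') : CodeEquiv C C'' := by
  rw [codeEquiv_iff] at h h' ⊢
  obtain ⟨a, σ, h⟩ := h
  obtain ⟨b, τ, h'⟩ := h'
  refine ⟨fun i => a i * b (σ i), σ.trans τ, fun y => ⟨fun hy => ?_, ?_⟩⟩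
  · obtain ⟨x, hx, hxy⟩ := (h' y).1 hy
    obtain ⟨z, hz, hzx⟩ := (h x).1 hx
    refine ⟨z, hz, fun j => ?_⟩
    rw [← hxy j, ← hzx]
    simp [mul_assoc]
  · rintro ⟨z, hz, hzy⟩
    refine (h' y).2 ⟨fun j => z (σ.symm j) * a (σ.symm j), (h _).2 ⟨z, hz, fun j => rfl⟩,
      fun j => ?_⟩
    rw [← hzy j]
    simp [mul_assoc]

/-- The Hermitian LCD `[n, k, d]` codes over `F` with dual distance `d^⊥ ≥ 2`. -/
def LCDCode (F : Type*) [Field F] [DecidableEq F] (n k d : ℕ) : Type _ :=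
  {C : Submodule F (Fin n → F) // IsCode C k d ∧ IsHermitianLCD C ∧ DualDistanceGeTwo C}

/-- Equivalence of codes, as an equivalence relation on the Hermitian LCD `[n, k, d]` codes with
dual distance `d^⊥ ≥ 2`. -/
instance lcdSetoid (F : Type*) [Field F] [DecidableEq F] (n k d : ℕ) :
    Setoid (LCDCode F n k d) where
  r C C' := CodeEquiv C.1 C'.1
  iseqv := ⟨fun C => codeEquiv_refl C.1, codeEquiv_symm, codeEquiv_trans⟩

/-- The set of equivalence classes of Hermitian LCD `[n, k, d]` codes with dual distance
`d^⊥ ≥ 2`. -/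
def LCDClasses (F : Type*) [Field F] [DecidableEq F] (n k d : ℕ) : Type _ :=
  Quotient (lcdSetoid F n k d)

end Codes

section Parameters

/-- The integer `r_{n,k,d} = 4^(k-1) n - ((4^k - 1)/3) d` (for `k ≥ 1`). -/
def rParam (n k d : ℕ) : ℤ :=
  4 ^ (k - 1) * (n : ℤ) - (((4 ^ k - 1) / 3 : ℕ) : ℤ) * (d : ℤ)

/-- `s'_{n,k,d} = (4 r_{n,k,d} - t) / ((4^k - 1)/3) + 1`, where `t` is the remainder of `n`
modulo `(4^k - 1)/3`. -/
def sParam (n k d : ℕ) : ℚ :=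
  (4 * (rParam n k d : ℚ) - ((n % ((4 ^ k - 1) / 3) : ℕ) : ℚ)) /
    (((4 ^ k - 1) / 3 : ℕ) : ℚ) + 1

/-- The tabulated values `α(t)`, `t = 0, …, 20`, in `d₄(21 s + t, 3) = 16 s + α(t)`. -/
def alphaTable : Fin 21 → ℤ :=
  ![-1, -1, 0, 1, 2, 3, 3, 4, 5, 6, 6, 7, 8, 9, 9, 10, 11, 12, 13, 13, 14]

/-- The tabulated values of `s'`, for `t = 0, …, 20`. -/
def sTable : Fin 21 → ℕ :=
  ![5, 8, 7, 6, 5, 4, 7, 6, 5, 4, 7, 6, 5, 4, 7, 6, 5, 4, 3, 6, 5]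

/-- The tabulated values of `r`, for `t = 0, …, 20`. -/
def rTable : Fin 21 → ℕ :=
  ![21, 37, 32, 27, 22, 17, 33, 28, 23, 18, 34, 29, 24, 19, 35, 30, 25, 20, 15, 31, 26]

end Parameters

end QuaternaryLCD

/-!
A generator matrix of a code of dimension `3` without zero coordinates is, up to equivalence, a
function `m` giving the multiplicities of the `21` points of the projective plane over `F`: by
`codeEquiv_range_iff`, equivalence of codes is the action of projectivities on `m`. The weight of a
codeword is the total multiplicity off a line. As `⟨x, x⟩_H` is the parity of the weight of `x`, a
code is Hermitian LCD if and only if the parity of its weights is a non-degenerate quadratic form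
(`nondeg_iff_parity`); adding all points of the plane increases every weight by `16` and preserves
this property.

Counting the lines off a point gives `m ≥ 4 d - 3 n` (`le_mult`). Writing `r = 16 n - 21 d`, this
says that removing copies of the plane, one at a time, is possible down to length `4 r`, whence the
one-to-one correspondence (`nonempty_lcdClasses_equiv`).

The value of `d₄(n, 3)` amounts to the fact that `r ≥ 15` and `r ≠ 16` for every Hermitian LCD code
(`excess_bound_of_nondeg`), while the other values of `r` in the table occur (`exists_attains`).
The bound comes from the signs `(-1) ^ wt` on the dual plane. A non-degenerate quadratic form on
`𝔽₂⁶` is bent, which fixes their sum (`sum_sign_eq`). Their sums off the points have known first and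
second moments, and congruences modulo `4`, so that the excess weights `wt - d`, of total `r`, have an
odd part of total `12` or `9` and an even part that cannot be too small (`excess_bound`).
-/

set_option linter.unusedSectionVars false

namespace QuaternaryLCD

open Matrix
open scoped LinearAlgebra.Projectivization

/-! ### The projective plane over the field with four elements -/

/-- The points of the projective plane over `F`. By means of the dot product they also stand for
its lines. -/
abbrev Pt (F : Type*) [Field F] := ℙ F (Fin 3 → F)

noncomputable instance {F : Type*} [Field F] [Finite F] : Fintype (Pt F) := Fintype.ofFinite _

/-- `avoid p q` is `1` if `p` does not lie on the line `q`, and `0` otherwise. -/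
noncomputable def avoid {F : Type*} [Field F] [DecidableEq F] (p q : Pt F) : ℤ :=
  if p.rep ⬝ᵥ q.rep = 0 then 0 else 1

section Plane

variable {F : Type*} [Field F] [Finite F] [DecidableEq F]

theorem rep_dotProduct_rep_eq_zero_iff (p q : Pt F) : p.rep ⬝ᵥ q.rep = 0 ↔ p ∈ q := by
  rw [Configuration.ofField.mem_iff]
  conv_rhs => rw [← p.mk_rep, ← q.mk_rep]
  rw [Projectivization.orthogonal_mk]

theorem avoid_eq (p q : Pt F) [Decidable (p ∈ q)] : avoid p q = 1 - if p ∈ q then 1 else 0 := by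
  simp only [avoid, rep_dotProduct_rep_eq_zero_iff]
  split_ifs <;> rfl

theorem avoid_comm (p q : Pt F) : avoid p q = avoid q p := by
  simp only [avoid, dotProduct_comm]

theorem card_pt (hF : Nat.card F = 4) : Fintype.card (Pt F) = 21 := by
  rw [← Nat.card_eq_fintype_card,
    Projectivization.card_of_finrank F (Fin 3 → F) (n := 3) (by simp), hF]
  rfl

theorem order_pt (hF : Nat.card F = 4) : Configuration.ProjectivePlane.order (Pt F) (Pt F) = 4 := by
  have h := Configuration.ProjectivePlane.card_points (Pt F) (Pt F)
  rw [card_pt hF] at h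
  nlinarith

theorem sum_avoid (hF : Nat.card F = 4) (q : Pt F) : ∑ p, avoid p q = 16 := by
  classical
  have h := Configuration.ProjectivePlane.pointCount_eq (Pt F) q
  rw [order_pt hF, Configuration.pointCount, Nat.card_eq_fintype_card, Fintype.card_subtype] at h
  simp only [avoid_eq, Finset.sum_sub_distrib, Finset.sum_boole, h]
  simp [card_pt hF]

/-- Through a point there are `5` lines and through two points there is one, so that `16` lines
avoid a point and `12` lines avoid two points. -/
theorem sum_avoid_mul_avoid (hF : Nat.card F = 4) (p q : Pt F) [Decidable (p = q)] :
    ∑ l, avoid l p * avoid l q = 12 + if p = q then 4 else 0 := by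
  classical
  split_ifs with hpq
  · subst hpq
    have : ∀ l, avoid l p * avoid l p = avoid l p := by
      intro l
      simp only [avoid]
      split_ifs <;> rfl
    simp only [this, sum_avoid hF]
    rfl
  · have h : ∑ l : Pt F, (if l ∈ p then 1 else 0 : ℤ) * (if l ∈ q then 1 else 0) = 1 := by
      obtain ⟨l, hl, hu⟩ := Configuration.HasPoints.existsUnique_point (Pt F) (Pt F) p q hpq
      rw [Finset.sum_eq_single l]
      · simp [hl.1, hl.2]
      · intro b _ hb
        by_contra hc
        apply hb
        apply hu
        simpa [and_comm] using hc
      · simp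
    have e : ∀ l : Pt F, avoid l p * avoid l q = avoid l p + avoid l q - 1
        + (if l ∈ p then 1 else 0 : ℤ) * (if l ∈ q then 1 else 0) := by
      intro l
      rw [avoid_eq, avoid_eq]
      ring
    simp only [e, Finset.sum_add_distrib, Finset.sum_sub_distrib, sum_avoid hF, h]
    simp [card_pt hF]

/-- For a function `f` on the lines, the function on the points which sums `f` over the lines
avoiding a point. -/
noncomputable def avoidSum (f : Pt F → ℤ) (p : Pt F) : ℤ := ∑ q, avoid p q * f q

theorem sum_avoidSum (hF : Nat.card F = 4) (f : Pt F → ℤ) :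
    ∑ p, avoidSum f p = 16 * ∑ q, f q := by
  simp only [avoidSum]
  rw [Finset.sum_comm, Finset.mul_sum]
  exact Finset.sum_congr rfl fun q _ => by rw [← Finset.sum_mul, sum_avoid hF]

theorem avoidSum_avoidSum (hF : Nat.card F = 4) (f : Pt F → ℤ) (p : Pt F) :
    avoidSum (avoidSum f) p = 4 * f p + 12 * ∑ q, f q := by
  classical
  have h : avoidSum (avoidSum f) p = ∑ q, (∑ l, avoid l p * avoid l q) * f q := by
    simp only [avoidSum, Finset.mul_sum, Finset.sum_mul]
    rw [Finset.sum_comm]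
    exact Finset.sum_congr rfl fun q _ => Finset.sum_congr rfl fun l _ => by
      rw [avoid_comm p l]
      ring
  rw [h]
  simp only [sum_avoid_mul_avoid hF, add_mul, Finset.sum_add_distrib, ← Finset.mul_sum, ite_mul,
    zero_mul, Finset.sum_ite_eq, Finset.mem_univ, if_true]
  ring

theorem sum_avoidSum_sq (hF : Nat.card F = 4) (f : Pt F → ℤ) :
    ∑ p, avoidSum f p ^ 2 = 12 * (∑ q, f q) ^ 2 + 4 * ∑ q, f q ^ 2 := by
  have h : ∑ p, avoidSum f p ^ 2 = ∑ q, f q * avoidSum (avoidSum f) q := by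
    simp only [sq]
    conv_lhs => enter [2, p]; rw [avoidSum, Finset.sum_mul]
    rw [Finset.sum_comm]
    refine Finset.sum_congr rfl fun q _ => ?_
    conv_rhs => rw [avoidSum, Finset.mul_sum]
    refine Finset.sum_congr rfl fun p _ => ?_
    rw [avoid_comm q p, avoidSum]
    ring
  rw [h]
  simp only [avoidSum_avoidSum hF, mul_add, Finset.sum_add_distrib, Finset.mul_sum]
  rw [sq, Finset.sum_mul, Finset.mul_sum, add_comm]
  congr 1
  · refine Finset.sum_congr rfl fun q _ => ?_
    rw [Finset.mul_sum, Finset.mul_sum]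
    exact Finset.sum_congr rfl fun q _ => by ring
  · exact Finset.sum_congr rfl fun q _ => by ring

theorem avoidSum_sub (f g : Pt F → ℤ) (p : Pt F) :
    avoidSum (fun q => f q - g q) p = avoidSum f p - avoidSum g p := by
  simp [avoidSum, mul_sub]

theorem avoidSum_add (f g : Pt F → ℤ) (p : Pt F) :
    avoidSum (fun q => f q + g q) p = avoidSum f p + avoidSum g p := by
  simp [avoidSum, mul_add, Finset.sum_add_distrib]

theorem avoidSum_mul_left (c : ℤ) (f : Pt F → ℤ) (p : Pt F) :
    avoidSum (fun q => c * f q) p = c * avoidSum f p := by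
  simp only [avoidSum, Finset.mul_sum]
  exact Finset.sum_congr rfl fun q _ => by ring

theorem avoidSum_const (hF : Nat.card F = 4) (c : ℤ) (p : Pt F) :
    avoidSum (fun _ => c) p = 16 * c := by
  simp only [avoidSum, ← Finset.sum_mul]
  simp only [avoid_comm p, sum_avoid hF]

/-- A function on `F³` which is constant on the non-zero multiples of each vector is summed over
the points of the plane, each of which has three non-zero representatives. -/
theorem sum_eq_add_three_mul_sum_pt [Fintype F] (hF : Nat.card F = 4) (f : (Fin 3 → F) → ℤ)
    (hf : ∀ (c : Fˣ) v, f (c • v) = f v) : ∑ v, f v = f 0 + 3 * ∑ p : Pt F, f p.rep := by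
  classical
  have h1 : ∑ v, f v = f 0 + ∑ v : {v : Fin 3 → F // v ≠ 0}, f v := by
    rw [← Finset.sum_subtype (Finset.univ.erase 0) (p := fun v => v ≠ 0) (by simp) f,
      Finset.add_sum_erase _ _ (Finset.mem_univ _)]
  rw [h1, ← Finset.sum_fiberwise Finset.univ (fun v => Projectivization.mk' F v), Finset.mul_sum]
  congr 1
  refine Finset.sum_congr rfl fun p _ => ?_
  have hc : ∀ v ∈ Finset.univ.filter
      (fun v : {v : Fin 3 → F // v ≠ 0} => Projectivization.mk' F v = p), f v = f p.rep := by
    intro v hv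
    obtain ⟨a, ha⟩ := Projectivization.exists_smul_eq_mk_rep F v.1 v.2
    rw [← (Finset.mem_filter.1 hv).2, Projectivization.mk'_eq_mk, ← ha, hf]
  rw [Finset.sum_congr rfl hc, Finset.sum_const, nsmul_eq_mul]
  congr 1
  have hb : Fintype.card Fˣ = 3 := by
    rw [Fintype.card_units, ← Nat.card_eq_fintype_card, hF]
  have : Finset.univ.filter
      (fun v : {v : Fin 3 → F // v ≠ 0} => Projectivization.mk' F v = p)
      = Finset.univ.image (fun c : Fˣ => (⟨c • p.rep, (smul_ne_zero_iff_ne c).2 p.rep_nonzero⟩ :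
          {v : Fin 3 → F // v ≠ 0})) := by
    ext ⟨v, hv⟩
    have := Projectivization.mk_eq_mk_iff F v p.rep hv p.rep_nonzero
    rw [p.mk_rep] at this
    rw [Finset.mem_image]
    refine ⟨fun h => ?_, fun ⟨c, _, hc⟩ => Finset.mem_filter.2 ⟨Finset.mem_univ _, ?_⟩⟩
    · obtain ⟨c, hc⟩ := this.1 (Finset.mem_filter.1 h).2
      exact ⟨c, Finset.mem_univ _, Subtype.ext hc⟩
    · exact this.2 ⟨c, congrArg Subtype.val hc⟩
  rw [this, Finset.card_image_of_injective, Finset.card_univ, hb]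
  · rfl
  · intro a b hab
    simp only [Subtype.mk.injEq] at hab
    have := smul_left_injective F p.rep_nonzero (show (a : F) • p.rep = (b : F) • p.rep from hab)
    exact Units.ext this

end Plane

/-! ### The bound from sign sums -/

section Nonexistence

variable {F : Type*} [Field F] [Finite F] [DecidableEq F]

/-- If `12` or `9` points of the dual plane carry the odd excess weights, as is the case for a
non-degenerate Hermitian form, then `R = 16 n - 21 d` is at least `15` and is not `16`. Write the
excess weight as `o + 2 h` with `o` its parity, and let `T` be the sum of `h` off a point. The
integrality of the multiplicities `m` makes the sums of the signs off a point equal to `4 σ` with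
`σ` an integer of the parity of `T`. The first two moments of `σ` force `σ ∈ {0, -1}`, so
that `T` is odd at exactly `12` points; this is impossible if the total of `h` is at most `2`. -/
theorem excess_bound (hF : Nat.card F = 4) (m W : Pt F → ℤ) (d : ℤ) (hW : ∀ q, W q = avoidSum m q)
    (hd : ∀ q, d ≤ W q) (hsign : ∑ q, (1 - 2 * (W q % 2)) = -3) :
    15 ≤ 16 * (∑ p, m p) - 21 * d ∧ 16 * (∑ p, m p) - 21 * d ≠ 16 := by
  set n := ∑ p, m p with hn
  set o : Pt F → ℤ := fun q => (W q - d) % 2 with ho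
  set h : Pt F → ℤ := fun q => (W q - d) / 2 with hh
  set H := ∑ q, h q with hH
  obtain ⟨ε, hε, hsg⟩ : ∃ ε : ℤ, (ε = 1 ∨ ε = -1) ∧ ∀ q, 1 - 2 * (W q % 2) = ε * (1 - 2 * o q) := by
    rcases Int.emod_two_eq_zero_or_one d with h0 | h0
    · exact ⟨1, Or.inl rfl, fun q => by simp only [ho]; omega⟩
    · exact ⟨-1, Or.inr rfl, fun q => by simp only [ho]; omega⟩
  have hh0 : ∀ q, 0 ≤ h q := fun q => by
    have := hd q
    simp only [hh]
    omega
  have hdec : ∀ q, W q - d = o q + 2 * h q := fun q => by simp only [ho, hh]; omega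
  have hcard : ∑ _q : Pt F, (1 : ℤ) = 21 := by simp [card_pt hF]
  have hsumW : ∑ q, W q = 16 * n := by
    simp only [hW]
    exact sum_avoidSum hF m
  have hR : 16 * n - 21 * d = ∑ q, o q + 2 * H := by
    have : ∑ q, (W q - d) = ∑ q, (o q + 2 * h q) := Finset.sum_congr rfl fun q _ => hdec q
    rw [Finset.sum_sub_distrib, hsumW, Finset.sum_add_distrib, ← Finset.mul_sum] at this
    simp [card_pt hF] at this
    linarith
  have ho2 : ε * (21 - 2 * ∑ q, o q) = -3 := by
    rw [← hsign, Finset.sum_congr rfl fun q _ => hsg q, ← Finset.mul_sum, Finset.sum_sub_distrib,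
      ← Finset.mul_sum, hcard]
  -- the sign sums off a point
  set S : Pt F → ℤ := avoidSum fun q => 1 - 2 * (W q % 2) with hS
  set T : Pt F → ℤ := avoidSum h with hT
  have hST : ∀ p, S p = 4 * (ε * (4 - 2 * m p - 6 * n + 8 * d + T p)) := by
    intro p
    have e1 : S p = ε * (16 - 2 * avoidSum o p) := by
      simp only [hS, hsg]
      rw [avoidSum_mul_left, avoidSum_sub, avoidSum_mul_left, avoidSum_const hF]
      ring
    have e2 : 4 * m p + 12 * n - 16 * d = avoidSum o p + 2 * T p := by
      have : avoidSum (fun q => W q - d) p = avoidSum (fun q => o q + 2 * h q) p := by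
        simp only [hdec]
      rw [avoidSum_sub, avoidSum_const hF, avoidSum_add, avoidSum_mul_left, funext hW,
        avoidSum_avoidSum hF] at this
      linarith
    rw [e1]
    have : avoidSum o p = 4 * m p + 12 * n - 16 * d - 2 * T p := by linarith
    rw [this]
    ring
  set σ : Pt F → ℤ := fun p => ε * (4 - 2 * m p - 6 * n + 8 * d + T p) with hσ
  have hσ1 : ∑ p, σ p = -12 := by
    have : ∑ p, S p = 16 * (-3) := by rw [← hsign]; exact sum_avoidSum hF _
    rw [Finset.sum_congr rfl fun p _ => hST p, ← Finset.mul_sum] at this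
    linarith
  have hσ2 : ∑ p, σ p ^ 2 = 12 := by
    have h1 : ∑ p, S p ^ 2 = 12 * (-3) ^ 2 + 4 * ∑ q : Pt F, (1 - 2 * (W q % 2)) ^ 2 := by
      rw [← hsign]; exact sum_avoidSum_sq hF _
    have h2 : ∀ q, (1 - 2 * (W q % 2)) ^ 2 = 1 := by
      intro q
      rcases Int.emod_two_eq_zero_or_one (W q) with h0 | h0 <;> rw [h0] <;> norm_num
    have h3 : ∀ p, S p ^ 2 = 16 * σ p ^ 2 := fun p => by rw [hST p]; ring
    simp only [h2, h3, hcard, ← Finset.mul_sum] at h1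
    linarith
  -- integers with `∑ σ (σ + 1) = 0` are all `0` or `-1`
  have hσ3 : ∀ p, σ p * (σ p + 1) = 0 := by
    have h0 : ∑ p, σ p * (σ p + 1) = 0 := by
      simp only [mul_add, mul_one, Finset.sum_add_distrib, ← sq, hσ1, hσ2]
      norm_num
    have hnn : ∀ x : ℤ, 0 ≤ x * (x + 1) := by
      intro x
      rcases le_or_gt 0 x with hx | hx <;> nlinarith
    intro p
    exact (Finset.sum_eq_zero_iff_of_nonneg fun p _ => hnn (σ p)).1 h0 p (Finset.mem_univ p)
  have hpar : ∀ p, (T p - σ p ^ 2) % 2 = 0 := by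
    intro p
    have h1 := hσ3 p
    have h2 : σ p ^ 2 = - σ p := by linarith
    rw [h2]
    simp only [hσ]
    rcases hε with rfl | rfl <;> omega
  have hσ01 : ∀ p, σ p ^ 2 = 0 ∨ σ p ^ 2 = 1 := by
    intro p
    rcases mul_eq_zero.1 (hσ3 p) with h0 | h0
    · left; rw [h0]; rfl
    · right
      have : σ p = -1 := by linarith
      rw [this]; rfl
  have hT0 : ∀ p, 0 ≤ T p := fun p => Finset.sum_nonneg fun q _ =>
    mul_nonneg (by simp only [avoid]; split_ifs <;> norm_num) (hh0 q)
  have hTH : ∀ p, T p ≤ H := fun p => Finset.sum_le_sum fun q _ => by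
    have := hh0 q
    simp only [avoid]
    split_ifs <;> linarith
  have hT1 : ∑ p, T p = 16 * H := sum_avoidSum hF h
  have hT2 : ∑ p, T p ^ 2 = 12 * H ^ 2 + 4 * ∑ q, h q ^ 2 := sum_avoidSum_sq hF h
  have hH0 : 0 ≤ H := Finset.sum_nonneg fun q _ => hh0 q
  by_contra hcon
  -- the total of `o` is `12` or `9` and has the parity of `16 n - 21 d`
  have hH2 : H ≤ 2 := by
    rcases hε with rfl | rfl <;> omega
  interval_cases hHv : H
  · have : ∀ p, σ p ^ 2 = 0 := fun p => by
      have h1 := hT0 p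
      have h2 := hTH p
      have h3 := hpar p
      rcases hσ01 p with h4 | h4 <;> omega
    simp [this] at hσ2
  · have : ∀ p, σ p ^ 2 = T p := fun p => by
      have h1 := hT0 p
      have h2 := hTH p
      have h3 := hpar p
      rcases hσ01 p with h4 | h4 <;> omega
    rw [Finset.sum_congr rfl fun p _ => this p, hT1] at hσ2
    norm_num at hσ2
  · have : ∀ p, σ p ^ 2 = 2 * T p - T p ^ 2 := fun p => by
      have h1 := hT0 p
      have h2 := hTH p
      have h3 := hpar p
      generalize T p = x at *
      interval_cases x <;> rcases hσ01 p with h4 | h4 <;> omega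
    rw [Finset.sum_congr rfl fun p _ => this p, Finset.sum_sub_distrib, ← Finset.mul_sum, hT1,
      hT2] at hσ2
    have : ∑ q, h q ≤ ∑ q, h q ^ 2 := Finset.sum_le_sum fun q _ => by
      nlinarith [hh0 q, sq_nonneg (h q - 1), Int.le_self_sq (h q)]
    linarith

end Nonexistence

/-! ### Weights and the Hermitian form of a generator matrix -/

section Form

variable {F : Type*} [Field F] [Finite F] [DecidableEq F] {ι : Type*} [Fintype ι]

/-- The weight of the codeword with message `y`. The matrix `G` is the transpose of a generator
matrix, so that its rows are indexed by the coordinates of the code. -/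
def wordWeight (G : Matrix ι (Fin 3) F) (y : Fin 3 → F) : ℕ := hammingNorm (G *ᵥ y)

/-- The Hermitian inner product of codewords, as a form on messages. -/
def hermForm (G : Matrix ι (Fin 3) F) (z y : Fin 3 → F) : F := ∑ i, (G *ᵥ z) i * (G *ᵥ y) i ^ 2

/-- The Hermitian form of `G` is non-degenerate. -/
def Nondeg (G : Matrix ι (Fin 3) F) : Prop := ∀ z, (∀ y, hermForm G z y = 0) → z = 0

theorem charP_two (hF : Nat.card F = 4) : CharP F 2 := by
  have := Fintype.ofFinite F
  have : Fact (Nat.Prime 2) := ⟨Nat.prime_two⟩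
  exact charP_of_card_eq_prime_pow (f := 2) (by rw [← Nat.card_eq_fintype_card, hF]; rfl)

theorem pow_four (hF : Nat.card F = 4) (x : F) : x ^ 4 = x := by
  have := Fintype.ofFinite F
  rw [← hF, Nat.card_eq_fintype_card]
  exact FiniteField.pow_card x

theorem pow_three (hF : Nat.card F = 4) {x : F} (hx : x ≠ 0) : x ^ 3 = 1 :=
  mul_right_cancel₀ hx (by rw [← pow_succ, pow_four hF, one_mul])

theorem exists_sq_add_self_ne_zero (hF : Nat.card F = 4) : ∃ w : F, w ^ 2 + w ≠ 0 := by
  have := charP_two hF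
  have := Fintype.ofFinite F
  by_contra! h
  have h1 : (Finset.univ : Finset F) ⊆ {0, 1} := fun x _ => by
    have : x * (x + 1) = 0 := by rw [← h x]; ring
    rcases mul_eq_zero.1 this with h0 | h0
    · simp [h0]
    · have := CharTwo.add_eq_zero.1 h0
      simp [this]
  have h2 := Finset.card_le_card h1
  rw [Finset.card_univ, ← Nat.card_eq_fintype_card, hF] at h2
  have := h2.trans Finset.card_le_two
  omega

theorem hermForm_self (hF : Nat.card F = 4) (G : Matrix ι (Fin 3) F) (y : Fin 3 → F) :
    hermForm G y y = (wordWeight G y : F) := by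
  rw [wordWeight, hammingNorm, Finset.card_filter, Nat.cast_sum, hermForm]
  refine Finset.sum_congr rfl fun i _ => ?_
  rw [← pow_succ']
  split_ifs with h
  · simp [pow_three hF h]
  · simp [not_not.1 h]

theorem hermForm_add_left (G : Matrix ι (Fin 3) F) (z z' y : Fin 3 → F) :
    hermForm G (z + z') y = hermForm G z y + hermForm G z' y := by
  simp only [hermForm, mulVec_add, Pi.add_apply, add_mul, Finset.sum_add_distrib]

theorem hermForm_add_right (hF : Nat.card F = 4) (G : Matrix ι (Fin 3) F) (z y y' : Fin 3 → F) :
    hermForm G z (y + y') = hermForm G z y + hermForm G z y' := by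
  have := charP_two hF
  simp only [hermForm, mulVec_add, Pi.add_apply, CharTwo.add_sq, mul_add, Finset.sum_add_distrib]

theorem hermForm_smul_left (G : Matrix ι (Fin 3) F) (c : F) (z y : Fin 3 → F) :
    hermForm G (c • z) y = c * hermForm G z y := by
  simp only [hermForm, mulVec_smul, Pi.smul_apply, smul_eq_mul, Finset.mul_sum, mul_assoc]

theorem hermForm_conj (hF : Nat.card F = 4) (G : Matrix ι (Fin 3) F) (z y : Fin 3 → F) :
    hermForm G z y ^ 2 = hermForm G y z := by
  have := charP_two hF
  rw [hermForm, CharTwo.sum_sq, hermForm]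
  refine Finset.sum_congr rfl fun i _ => ?_
  rw [mul_pow, ← pow_mul, pow_four hF, mul_comm]

theorem hermForm_smul_right (hF : Nat.card F = 4) (G : Matrix ι (Fin 3) F) (c : F)
    (z y : Fin 3 → F) : hermForm G z (c • y) = c ^ 2 * hermForm G z y := by
  rw [← hermForm_conj hF, hermForm_smul_left, mul_pow, hermForm_conj hF]

theorem cast_wordWeight_add (hF : Nat.card F = 4) (G : Matrix ι (Fin 3) F) (y z : Fin 3 → F) :
    (wordWeight G (y + z) : F)
      = wordWeight G y + wordWeight G z + (hermForm G y z + hermForm G z y) := by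
  simp only [← hermForm_self hF, hermForm_add_left, hermForm_add_right hF]
  ring

/-- The trace of a Hermitian form determines the form. -/
theorem hermForm_eq_zero_of_trace (hF : Nat.card F = 4) (G : Matrix ι (Fin 3) F) (y : Fin 3 → F)
    (h : ∀ z, hermForm G y z + hermForm G z y = 0) (z : Fin 3 → F) : hermForm G y z = 0 := by
  have := charP_two hF
  obtain ⟨w, hw⟩ := exists_sq_add_self_ne_zero hF
  have h1 := CharTwo.add_eq_zero.1 (h z)
  have h2 := h (w • z)
  rw [hermForm_smul_left, hermForm_smul_right hF, ← h1, ← add_mul] at h2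
  exact (mul_eq_zero.1 h2).resolve_left hw

theorem cast_eq_cast_iff (hF : Nat.card F = 4) (a b : ℕ) : (a : F) = b ↔ a % 2 = b % 2 := by
  have := charP_two hF
  exact CharP.cast_eq_iff_mod_eq F 2

/-- Non-degeneracy is a property of the parities of the weights: the radical of the form consists
of the periods of the parity function. -/
theorem nondeg_iff_parity (hF : Nat.card F = 4) (G : Matrix ι (Fin 3) F) :
    Nondeg G ↔ ∀ y, (∀ z, wordWeight G (y + z) % 2 = wordWeight G z % 2) → y = 0 := by
  have := charP_two hF
  simp only [← cast_eq_cast_iff hF]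
  refine forall_congr' fun y => imp_congr_left ⟨fun h z => ?_, fun h => ?_⟩
  · rw [cast_wordWeight_add hF, ← hermForm_conj hF G y z, h z, ← hermForm_self hF G y, h y]
    simp
  · have h0 : (wordWeight G y : F) = 0 := by
      have := h 0
      rw [add_zero] at this
      rw [this, ← hermForm_self hF, hermForm]
      simp
    refine hermForm_eq_zero_of_trace hF G y fun z => ?_
    have := h z
    rw [cast_wordWeight_add hF, h0, zero_add] at this
    exact left_eq_add.1 this.symm

theorem nondeg_congr (hF : Nat.card F = 4) {κ : Type*} [Fintype κ] {G : Matrix ι (Fin 3) F}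
    {G' : Matrix κ (Fin 3) F} (h : ∀ y, wordWeight G y % 2 = wordWeight G' y % 2) :
    Nondeg G ↔ Nondeg G' := by
  rw [nondeg_iff_parity hF, nondeg_iff_parity hF]
  simp only [h]

theorem wordWeight_zero (G : Matrix ι (Fin 3) F) : wordWeight G 0 = 0 := by
  simp [wordWeight]

theorem wordWeight_smul (G : Matrix ι (Fin 3) F) (c : Fˣ) (y : Fin 3 → F) :
    wordWeight G (c • y) = wordWeight G y := by
  simp [wordWeight, hammingNorm, mulVec_smul, Units.smul_def]

/-- The parity of the weights is a quadratic form on `𝔽₂⁶`, non-degenerate if the Hermitian form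
is. Hence the sum of its signs over all `64` messages is `8` or `-8`; by homogeneity it is `1` modulo
`3`, hence `-8`. Per point of the plane, the signs sum up to `-3`. -/
theorem sum_sign_eq (hF : Nat.card F = 4) (G : Matrix ι (Fin 3) F) (hG : Nondeg G) :
    ∑ q : Pt F, (1 - 2 * ((wordWeight G q.rep : ℤ) % 2)) = -3 := by
  have := charP_two hF
  have := Fintype.ofFinite F
  set e : (Fin 3 → F) → ℤ := fun y => 1 - 2 * ((wordWeight G y : ℤ) % 2) with he
  have hsum := sum_eq_add_three_mul_sum_pt hF e fun c v => by simp only [he, wordWeight_smul]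
  have he0 : e 0 = 1 := by simp [he, wordWeight_zero]
  -- a translation of `z` by `z₀` flips the sign of `e (y + z) * e z`
  have hcorr : ∀ y, y ≠ 0 → ∑ z, e (y + z) * e z = 0 := by
    intro y hy
    obtain ⟨z₀, hz₀⟩ : ∃ z, hermForm G y z + hermForm G z y ≠ 0 := by
      by_contra! h
      exact hy (hG y (hermForm_eq_zero_of_trace hF G y h))
    have hflip : ∀ z, e (y + (z + z₀)) * e (z + z₀) = - (e (y + z) * e z) := by
      intro z
      have h1 : ((wordWeight G (y + (z + z₀)) + wordWeight G (z + z₀) +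
          (wordWeight G (y + z) + wordWeight G z) : ℕ) : F) ≠ ((0 : ℕ) : F) := by
        push_cast
        rw [cast_wordWeight_add hF G y (z + z₀), cast_wordWeight_add hF G y z,
          hermForm_add_left, hermForm_add_right hF]
        intro h0
        apply hz₀
        rw [← h0]
        have := CharTwo.two_eq_zero (R := F)
        linear_combination (-(wordWeight G y + hermForm G y z + hermForm G z y +
          wordWeight G (z + z₀) + wordWeight G z : F)) * this
      rw [Ne, cast_eq_cast_iff hF] at h1
      simp only [he]
      have key : ∀ a b c d : ℤ, (a + b + (c + d)) % 2 ≠ 0 →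
          (1 - 2 * (a % 2)) * (1 - 2 * (b % 2)) = -((1 - 2 * (c % 2)) * (1 - 2 * (d % 2))) := by
        intro a b c d h
        rcases Int.emod_two_eq_zero_or_one a with ha | ha <;>
        rcases Int.emod_two_eq_zero_or_one b with hb | hb <;>
        rcases Int.emod_two_eq_zero_or_one c with hc | hc <;>
        rcases Int.emod_two_eq_zero_or_one d with hd | hd <;>
        first
        | (exfalso; omega)
        | (rw [ha, hb, hc, hd]; norm_num)
      exact key _ _ _ _ (by omega)
    have h2 : ∑ z, e (y + (z + z₀)) * e (z + z₀) = ∑ z, e (y + z) * e z :=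
      Fintype.sum_equiv (Equiv.addRight z₀) _ _ fun z => rfl
    simp only [hflip, Finset.sum_neg_distrib] at h2
    linarith
  have hsq : (∑ y, e y) ^ 2 = 64 := by
    have h1 : (∑ y, e y) ^ 2 = ∑ y, ∑ z, e (y + z) * e z := by
      rw [sq, Finset.sum_comm, Finset.mul_sum]
      refine Finset.sum_congr rfl fun z _ => ?_
      rw [← Finset.sum_mul]
      congr 1
      exact (Fintype.sum_equiv (Equiv.addRight z) _ _ fun y => rfl).symm
    rw [h1, Finset.sum_eq_single 0 (fun y _ hy => hcorr y hy) (by simp)]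
    have h2 : ∀ z, e (0 + z) * e z = 1 := by
      intro z
      simp only [he, zero_add]
      rcases Int.emod_two_eq_zero_or_one (wordWeight G z) with h0 | h0 <;> rw [h0] <;> norm_num
    simp only [h2, Finset.sum_const, Finset.card_univ, Fintype.card_fun, Fintype.card_fin]
    rw [← Nat.card_eq_fintype_card, hF]
    norm_num
  rw [hsum, he0] at hsq
  change ∑ q : Pt F, e q.rep = -3
  generalize ∑ q : Pt F, e q.rep = x at *
  have : (x + 3) * (3 * x - 7) = 0 := by linarith
  rcases mul_eq_zero.1 this with h | h <;> omega

end Form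

/-! ### Multiplicities of points -/

section Mult

variable {F : Type*} [Field F] [Finite F] [DecidableEq F] {ι : Type*} [Fintype ι]

open Classical in
/-- The number of coordinates whose column in the generator matrix represents the point `p`.
Zero columns represent no point. -/
noncomputable def mult (G : Matrix ι (Fin 3) F) (p : Pt F) : ℕ :=
  (Finset.univ.filter fun i => ∃ c : Fˣ, c • p.rep = G i).card

theorem exists_smul_rep_eq_iff {v : Fin 3 → F} (hv : v ≠ 0) (p : Pt F) :
    (∃ c : Fˣ, c • p.rep = v) ↔ Projectivization.mk F v hv = p := by
  have := Projectivization.mk_eq_mk_iff F v p.rep hv p.rep_nonzero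
  rw [p.mk_rep] at this
  exact this.symm

theorem existsUnique_smul_rep_eq {v : Fin 3 → F} (hv : v ≠ 0) :
    ∃! p : Pt F, ∃ c : Fˣ, c • p.rep = v := by
  refine ⟨Projectivization.mk F v hv, (exists_smul_rep_eq_iff hv _).2 rfl, fun q hq => ?_⟩
  exact ((exists_smul_rep_eq_iff hv _).1 hq).symm

open Classical in
theorem sum_card_filter_eq (G : Matrix ι (Fin 3) F) (s : ι → Prop) [DecidablePred s]
    (hs : ∀ i, s i → G i ≠ 0) :
    ∑ p : Pt F, (Finset.univ.filter fun i => s i ∧ ∃ c : Fˣ, c • p.rep = G i).card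
      = (Finset.univ.filter s).card := by
  simp only [Finset.card_filter]
  rw [Finset.sum_comm]
  refine Finset.sum_congr rfl fun i _ => ?_
  by_cases hi : s i
  · obtain ⟨p, hp, hu⟩ := existsUnique_smul_rep_eq (hs i hi)
    rw [Finset.sum_eq_single p]
    · simp only [hi, hp, and_self, if_true]
    · intro q _ hq
      exact if_neg fun h => hq (hu q h.2)
    · simp
  · simp [hi]

open Classical in
theorem sum_mult (G : Matrix ι (Fin 3) F) :
    ∑ p, mult G p = (Finset.univ.filter fun i => G i ≠ 0).card := by
  refine Eq.trans ?_ (sum_card_filter_eq G (fun i => G i ≠ 0) fun i hi => hi)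
  refine Finset.sum_congr rfl fun p _ => ?_
  rw [mult]
  congr 1
  refine Finset.filter_congr fun i _ => ⟨fun h => ⟨?_, h⟩, fun h => h.2⟩
  obtain ⟨c, hc⟩ := h
  rw [← hc]
  exact (smul_ne_zero_iff_ne c).2 p.rep_nonzero

theorem sum_mult_of_ne_zero (G : Matrix ι (Fin 3) F) (hG : ∀ i, G i ≠ 0) :
    ∑ p, mult G p = Fintype.card ι := by
  classical
  rw [sum_mult, Finset.filter_true_of_mem fun i _ => hG i, Finset.card_univ]

theorem wordWeight_eq_sum (G : Matrix ι (Fin 3) F) (y : Fin 3 → F) :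
    wordWeight G y = ∑ p : Pt F, if p.rep ⬝ᵥ y = 0 then 0 else mult G p := by
  classical
  have h := sum_card_filter_eq G (fun i => G i ⬝ᵥ y ≠ 0) fun i hi h0 => hi (by simp [h0])
  rw [wordWeight, hammingNorm]
  refine Eq.trans h.symm ?_
  refine Finset.sum_congr rfl fun p _ => ?_
  have key : ∀ i, (∃ c : Fˣ, c • p.rep = G i) → (G i ⬝ᵥ y = 0 ↔ p.rep ⬝ᵥ y = 0) := by
    rintro i ⟨c, hc⟩
    rw [← hc, Units.smul_def, smul_dotProduct, smul_eq_mul, mul_eq_zero,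
      or_iff_right c.ne_zero]
  split_ifs with hy
  · rw [Finset.card_eq_zero, Finset.filter_eq_empty_iff]
    rintro i _ ⟨h1, h2⟩
    exact h1 ((key i h2).2 hy)
  · rw [mult]
    congr 1
    exact Finset.filter_congr fun i _ => ⟨fun h => h.2, fun h => ⟨fun h0 => hy ((key i h).1 h0), h⟩⟩

theorem wordWeight_rep (G : Matrix ι (Fin 3) F) (q : Pt F) :
    (wordWeight G q.rep : ℤ) = avoidSum (fun p => (mult G p : ℤ)) q := by
  rw [wordWeight_eq_sum, Nat.cast_sum, avoidSum]
  refine Finset.sum_congr rfl fun p _ => ?_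
  rw [avoid_comm, avoid]
  split_ifs <;> simp

/-- Every multiplicity function comes from a matrix. -/
theorem exists_mult_eq (m : Pt F → ℕ) {n : ℕ} (hn : ∑ p, m p = n) :
    ∃ G : Matrix (Fin n) (Fin 3) F, (∀ i, G i ≠ 0) ∧ mult G = m := by
  classical
  have hc : Fintype.card (Σ p : Pt F, Fin (m p)) = n := by simp [hn]
  let e := (Fintype.equivFinOfCardEq hc).symm
  refine ⟨fun i => (e i).1.rep, fun i => (e i).1.rep_nonzero, funext fun p => ?_⟩
  have h1 : ∀ i, (∃ c : Fˣ, c • p.rep = (e i).1.rep) ↔ (e i).1 = p := fun i => by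
    rw [exists_smul_rep_eq_iff (e i).1.rep_nonzero, Projectivization.mk_rep]
  have h2 : mult (fun i => (e i).1.rep) p = (Finset.univ.filter fun i => (e i).1 = p).card := by
    unfold mult
    congr 1
    exact Finset.filter_congr fun i _ => h1 i
  rw [h2, Finset.card_filter,
    Fintype.sum_equiv e _ (fun x => if x.1 = p then 1 else 0) fun i => rfl, Fintype.sum_sigma,
    Finset.sum_eq_single p]
  · simp
  · intro q _ hq
    simp [hq]
  · simp

theorem wordWeight_of_mult_add {κ : Type*} [Fintype κ] (hF : Nat.card F = 4)
    (G : Matrix ι (Fin 3) F) (G' : Matrix κ (Fin 3) F) (k : ℕ)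
    (h : ∀ p, mult G' p = mult G p + k) {y : Fin 3 → F} (hy : y ≠ 0) :
    wordWeight G' y = wordWeight G y + 16 * k := by
  obtain ⟨a, ha⟩ := Projectivization.exists_smul_eq_mk_rep F y hy
  have h1 := wordWeight_rep G (Projectivization.mk F y hy)
  have h2 := wordWeight_rep G' (Projectivization.mk F y hy)
  rw [← ha, wordWeight_smul] at h1 h2
  simp only [h, Nat.cast_add] at h2
  rw [avoidSum_add, avoidSum_const hF] at h2
  omega

/-- Adding every point of the plane `k` times does not affect non-degeneracy. -/
theorem nondeg_iff_of_mult_add {κ : Type*} [Fintype κ] (hF : Nat.card F = 4)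
    (G : Matrix ι (Fin 3) F) (G' : Matrix κ (Fin 3) F) (k : ℕ)
    (h : ∀ p, mult G' p = mult G p + k) : Nondeg G ↔ Nondeg G' := by
  refine nondeg_congr hF fun y => ?_
  by_cases hy : y = 0
  · simp [hy, wordWeight_zero]
  · rw [wordWeight_of_mult_add hF G G' k h hy]
    omega

theorem le_wordWeight_rep {G : Matrix ι (Fin 3) F} {d : ℕ} (h : ∀ y ≠ 0, d ≤ wordWeight G y)
    (q : Pt F) : (d : ℤ) ≤ avoidSum (fun p => (mult G p : ℤ)) q := by
  rw [← wordWeight_rep]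
  exact_mod_cast h _ q.rep_nonzero

/-- The lines avoiding a point have total weight `12 n + 4 m`, with `m` the multiplicity of the
point; hence a point occurs often in a code with large minimum weight. -/
theorem le_mult (hF : Nat.card F = 4) (G : Matrix ι (Fin 3) F) (hG : ∀ i, G i ≠ 0) {d : ℕ}
    (h : ∀ y ≠ 0, d ≤ wordWeight G y) (p : Pt F) :
    4 * d ≤ 3 * Fintype.card ι + mult G p := by
  have h1 := avoidSum_avoidSum hF (fun p => (mult G p : ℤ)) p
  have h2 : avoidSum (fun _ => (d : ℤ)) p ≤ avoidSum (avoidSum fun p => (mult G p : ℤ)) p :=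
    Finset.sum_le_sum fun q _ => mul_le_mul_of_nonneg_left (le_wordWeight_rep h q)
      (by rw [avoid]; split_ifs <;> norm_num)
  rw [avoidSum_const hF, h1] at h2
  have h3 : ∑ p, (mult G p : ℤ) = Fintype.card ι := by exact_mod_cast sum_mult_of_ne_zero G hG
  rw [h3] at h2
  omega

/-- The bound of `excess_bound` for matrices; zero rows only increase `16 n - 21 d`. -/
theorem excess_bound_of_nondeg (hF : Nat.card F = 4) (G : Matrix ι (Fin 3) F) (hG : Nondeg G)
    {d : ℕ} (h : ∀ y ≠ 0, d ≤ wordWeight G y) :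
    21 * d + 15 ≤ 16 * Fintype.card ι ∧ 21 * d + 16 ≠ 16 * Fintype.card ι := by
  classical
  have h1 := excess_bound hF (fun p => (mult G p : ℤ)) (fun q => (wordWeight G q.rep : ℤ)) d
    (wordWeight_rep G) (fun q => by exact_mod_cast h _ q.rep_nonzero) (sum_sign_eq hF G hG)
  have h2 : ∑ p, (mult G p : ℤ) = ((Finset.univ.filter fun i => G i ≠ 0).card : ℤ) := by
    exact_mod_cast sum_mult G
  have h3 : (Finset.univ.filter fun i => G i ≠ 0).card ≤ Fintype.card ι := Finset.card_le_univ _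
  rw [h2] at h1
  omega

end Mult

/-! ### Codes and their generator matrices -/

section Generators

variable {F : Type*} [Field F] [Finite F] [DecidableEq F] {n : ℕ}

theorem exists_generator {C : Submodule F (Fin n → F)} (hC : Module.finrank F C = 3) :
    ∃ G : Matrix (Fin n) (Fin 3) F,
      Function.Injective G.mulVec ∧ LinearMap.range G.mulVecLin = C := by
  let b := Module.finBasisOfFinrankEq F C hC
  let f : (Fin 3 → F) →ₗ[F] (Fin n → F) := C.subtype ∘ₗ b.equivFun.symm.toLinearMap
  have hf : (LinearMap.toMatrix' f).mulVecLin = f := by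
    rw [← Matrix.toLin'_apply', Matrix.toLin'_toMatrix']
  refine ⟨LinearMap.toMatrix' f, ?_, ?_⟩
  · have : Function.Injective f := C.injective_subtype.comp b.equivFun.symm.injective
    rw [← hf] at this
    exact this
  · rw [hf, LinearMap.range_comp_of_range_eq_top _ (LinearEquiv.range _), Submodule.range_subtype]

theorem mulVec_ne_zero {G : Matrix (Fin n) (Fin 3) F} (hG : Function.Injective G.mulVec)
    {y : Fin 3 → F} (hy : y ≠ 0) : G *ᵥ y ≠ 0 := fun h =>
  hy (hG (by rw [h, mulVec_zero]))

theorem injective_of_pos {G : Matrix (Fin n) (Fin 3) F} (h : ∀ y ≠ 0, 0 < wordWeight G y) :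
    Function.Injective G.mulVec := by
  intro y z hyz
  by_contra hne
  have := h (y - z) (sub_ne_zero.2 hne)
  rw [wordWeight, mulVec_sub, sub_eq_zero.2 hyz, hammingNorm_zero] at this
  exact lt_irrefl _ this

theorem isCode_range_iff {G : Matrix (Fin n) (Fin 3) F} (hG : Function.Injective G.mulVec)
    (d : ℕ) : IsCode (LinearMap.range G.mulVecLin) 3 d ↔
      (∃ y ≠ 0, wordWeight G y = d) ∧ ∀ y ≠ 0, d ≤ wordWeight G y := by
  have h1 : Module.finrank F (LinearMap.range G.mulVecLin) = 3 := by
    rw [LinearMap.finrank_range_of_inj (f := G.mulVecLin) hG]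
    simp
  have h2 : nonzeroWeights (LinearMap.range G.mulVecLin) = {w | ∃ y ≠ 0, wordWeight G y = w} := by
    ext w
    constructor
    · rintro ⟨_, ⟨y, rfl⟩, hy, hw⟩
      exact ⟨y, fun h0 => hy (by simp [h0]), hw⟩
    · rintro ⟨y, hy, hw⟩
      exact ⟨_, ⟨y, rfl⟩, mulVec_ne_zero hG hy, hw⟩
  rw [IsCode, h2, IsLeast, mem_lowerBounds]
  simp only [h1, true_and, Set.mem_ofPred_eq]
  refine and_congr_right fun _ => ⟨fun h y hy => h _ ⟨y, hy, rfl⟩, ?_⟩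
  rintro h _ ⟨y, hy, rfl⟩
  exact h y hy

theorem isHermitianLCD_range_iff {G : Matrix (Fin n) (Fin 3) F}
    (hG : Function.Injective G.mulVec) :
    IsHermitianLCD (LinearMap.range G.mulVecLin) ↔ Nondeg G := by
  rw [IsHermitianLCD, Submodule.eq_bot_iff]
  constructor
  · intro h z hz
    by_contra hne
    refine mulVec_ne_zero hG hne (h _ ⟨⟨z, rfl⟩, ?_⟩)
    rintro _ ⟨y, rfl⟩
    exact hz y
  · rintro h _ ⟨⟨z, rfl⟩, hz⟩
    have : z = 0 := h z fun y => hz _ ⟨y, rfl⟩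
    simp [this]

theorem dualDistanceGeTwo_range_iff (G : Matrix (Fin n) (Fin 3) F) :
    DualDistanceGeTwo (LinearMap.range G.mulVecLin) ↔ ∀ i, G i ≠ 0 := by
  constructor
  · intro h i hi
    have h1 := h 1 ⟨Pi.single i 1, ?_, ?_, ?_⟩
    · omega
    · rintro _ ⟨y, rfl⟩
      rw [hermInner, Finset.sum_eq_single i]
      · have : (G.mulVecLin y) i = G i ⬝ᵥ y := rfl
        simp [this, hi]
      · intro j _ hj
        simp [hj]
      · simp
    · simp
    · rw [hammingNorm, Finset.card_eq_one]
      refine ⟨i, ?_⟩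
      ext j
      simp [Pi.single_apply]
  · rintro h _ ⟨x, hx, hx0, rfl⟩
    by_contra! hlt
    obtain ⟨i, hi⟩ := Function.ne_iff.1 hx0
    have hj : ∀ j, j ≠ i → x j = 0 := by
      intro j hj
      by_contra hxj
      exact hj (Finset.card_le_one.1 (Nat.le_of_lt_succ hlt) j (by simpa using hxj) i
        (by simpa using hi))
    refine h i (dotProduct_eq_zero _ fun y => ?_)
    have h1 := hx _ ⟨y, rfl⟩
    rw [hermInner, Finset.sum_eq_single i (fun j _ hji => by simp [hj j hji]) (by simp)] at h1
    exact pow_eq_zero_iff two_ne_zero |>.1 ((mul_eq_zero.1 h1).resolve_left hi)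

/-- Two multiplicity functions are related by a projectivity of the plane, given by an invertible
matrix acting on row vectors. -/
def ProjEquiv (m m' : Pt F → ℕ) : Prop :=
  ∃ (B : Matrix (Fin 3) (Fin 3) F) (hB : Function.Injective B.vecMulLinear),
    ∀ p, m' (Projectivization.map B.vecMulLinear hB p) = m p

theorem projEquiv_add_iff (m m' : Pt F → ℕ) (k : ℕ) :
    ProjEquiv (fun p => m p + k) (fun p => m' p + k) ↔ ProjEquiv m m' := by
  simp only [ProjEquiv, add_left_inj]

theorem mult_eq_card {G : Matrix (Fin n) (Fin 3) F} (hG : ∀ i, G i ≠ 0) (p : Pt F) :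
    mult G p = Nat.card {i // Projectivization.mk F (G i) (hG i) = p} := by
  classical
  rw [Nat.card_eq_fintype_card, Fintype.card_subtype, mult]
  congr 1
  exact Finset.filter_congr fun i _ => exists_smul_rep_eq_iff (hG i) p

theorem codeEquiv_range_iff_rows {G G' : Matrix (Fin n) (Fin 3) F}
    (hG' : Function.Injective G'.mulVec) :
    CodeEquiv (LinearMap.range G.mulVecLin) (LinearMap.range G'.mulVecLin) ↔
      ∃ (B : Matrix (Fin 3) (Fin 3) F) (_ : Function.Injective B.vecMulLinear)
        (a : Fin n → Fˣ) (σ : Equiv.Perm (Fin n)), ∀ i, G' (σ i) = a i • (G i ᵥ* B) := by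
  have hBiff : ∀ B : Matrix (Fin 3) (Fin 3) F, Function.Injective B.vecMulLinear ↔ IsUnit B :=
    fun B => vecMul_injective_iff_isUnit
  rw [codeEquiv_iff]
  constructor
  · rintro ⟨a, σ, h⟩
    have h1 : ∀ k : Fin 3, ∃ u : Fin 3 → F, ∀ j,
        (G *ᵥ u) (σ.symm j) * a (σ.symm j) = (G' *ᵥ Pi.single k 1) j := by
      intro k
      obtain ⟨_, ⟨u, rfl⟩, hu⟩ := (h (G' *ᵥ Pi.single k 1)).1 ⟨_, rfl⟩
      exact ⟨u, hu⟩
    choose u hu using h1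
    -- the columns of `B` are the messages whose codewords match those of the basis for `G'`
    let B : Matrix (Fin 3) (Fin 3) F := fun l k => u k l
    have hrow : ∀ i, G' (σ i) = a i • (G i ᵥ* B) := by
      intro i
      ext k
      have := hu k (σ i)
      rw [Equiv.symm_apply_apply, mulVec_single_one] at this
      change _ = G' (σ i) k at this
      rw [← this, mul_comm]
      rfl
    refine ⟨B, ?_, a, σ, hrow⟩
    rw [hBiff, ← mulVec_injective_iff_isUnit, ← coe_mulVecLin, ← LinearMap.ker_eq_bot,
      LinearMap.ker_eq_bot']
    intro v hv
    have hv' : B *ᵥ v = 0 := hv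
    apply hG'
    rw [mulVec_zero]
    ext j
    change G' j ⬝ᵥ v = 0
    rw [← σ.apply_symm_apply j, hrow, Units.smul_def, smul_dotProduct, ← dotProduct_mulVec, hv']
    simp
  · rintro ⟨B, hB, a, σ, hrow⟩
    have hu := (hBiff B).1 hB
    have hdot : ∀ u j, (G *ᵥ (B *ᵥ u)) (σ.symm j) * a (σ.symm j) = (G' *ᵥ u) j := by
      intro u j
      change (G (σ.symm j) ⬝ᵥ (B *ᵥ u)) * _ = G' j ⬝ᵥ u
      conv_rhs => rw [← σ.apply_symm_apply j, hrow, Units.smul_def, smul_dotProduct]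
      rw [← dotProduct_mulVec, smul_eq_mul, mul_comm]
    refine ⟨a, σ, fun y => ⟨?_, ?_⟩⟩
    · rintro ⟨u, rfl⟩
      exact ⟨_, ⟨B *ᵥ u, rfl⟩, hdot u⟩
    · rintro ⟨_, ⟨u, rfl⟩, hy⟩
      obtain ⟨v, rfl⟩ := (mulVec_surjective_iff_isUnit.2 hu) u
      exact ⟨v, funext fun j => by rw [← hy j]; exact (hdot v j).symm⟩

/-- Codes without zero coordinates are equivalent if and only if the multiplicity functions of
their generator matrices are related by a projectivity. -/
theorem codeEquiv_range_iff {G G' : Matrix (Fin n) (Fin 3) F}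
    (hG' : Function.Injective G'.mulVec) (h : ∀ i, G i ≠ 0) (h' : ∀ i, G' i ≠ 0) :
    CodeEquiv (LinearMap.range G.mulVecLin) (LinearMap.range G'.mulVecLin) ↔
      ProjEquiv (mult G) (mult G') := by
  rw [codeEquiv_range_iff_rows hG']
  refine exists_congr fun B => exists_congr fun hB => ?_
  have hne : ∀ i, G i ᵥ* B ≠ 0 := fun i h0 => h i (hB (by
    rw [map_zero]
    exact h0))
  have hmk : ∀ i, Projectivization.map B.vecMulLinear hB (Projectivization.mk F (G i) (h i))
      = Projectivization.mk F (G i ᵥ* B) (hne i) := fun i => rfl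
  have hrow : ∀ i j, (∃ a : Fˣ, G' j = a • (G i ᵥ* B)) ↔ Projectivization.mk F (G' j) (h' j)
      = Projectivization.map B.vecMulLinear hB (Projectivization.mk F (G i) (h i)) := by
    intro i j
    rw [hmk, Projectivization.mk_eq_mk_iff]
    exact exists_congr fun a => eq_comm
  have hinj := Projectivization.map_injective B.vecMulLinear hB
  constructor
  · rintro ⟨a, σ, ha⟩ p
    rw [mult_eq_card h, mult_eq_card h']
    refine (Nat.card_congr (σ.subtypeEquiv fun i => ?_)).symm
    rw [(hrow i (σ i)).1 ⟨a i, ha i⟩, hinj.eq_iff]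
  · intro hm
    have hfib : ∀ p : Pt F, Nonempty ({i // Projectivization.map B.vecMulLinear hB
        (Projectivization.mk F (G i) (h i)) = p} ≃ {j // Projectivization.mk F (G' j) (h' j) = p}) := by
      intro p
      obtain ⟨q, rfl⟩ := Finite.injective_iff_surjective.1 hinj p
      refine Finite.card_eq.1 ?_
      rw [← mult_eq_card h', hm, mult_eq_card h]
      simp only [hinj.eq_iff]
    let σ := Equiv.ofFiberEquiv fun p => (hfib p).some
    have hσ : ∀ i, ∃ a : Fˣ, G' (σ i) = a • (G i ᵥ* B) := fun i =>
      (hrow i (σ i)).2 (Equiv.ofFiberEquiv_map (fun p => (hfib p).some) i)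
    choose a ha using hσ
    exact ⟨a, σ, ha⟩

end Generators

/-! ### Codes with large minimum weight -/

section Existence

variable {F : Type*} [Field F] [Finite F] [DecidableEq F]

theorem wordWeight_fromRows {ι κ : Type*} [Fintype ι] [Fintype κ] (T : Matrix ι (Fin 3) F)
    (S : Matrix κ (Fin 3) F) (y : Fin 3 → F) :
    wordWeight (fromRows T S) y = wordWeight T y + wordWeight S y := by
  simp only [wordWeight, hammingNorm, Finset.card_filter, fromRows_mulVec, Fintype.sum_sum_type]
  rfl

/-- There is a Hermitian LCD code of length `n` and dimension `3` with minimum weight at least `d`;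
zero coordinates are permitted. -/
def Attains (F : Type*) [Field F] [DecidableEq F] (n d : ℕ) : Prop :=
  ∃ G : Matrix (Fin n) (Fin 3) F, Nondeg G ∧ ∀ y ≠ 0, d ≤ wordWeight G y

theorem Attains.of_matrix {ι : Type*} [Fintype ι] (G : Matrix ι (Fin 3) F) {n d : ℕ}
    (hn : Fintype.card ι = n) (hG : Nondeg G) (h : ∀ y ≠ 0, d ≤ wordWeight G y) :
    Attains F n d := by
  let e := (Fintype.equivFinOfCardEq hn).symm
  have h1 : ∀ z y, hermForm (G.submatrix e id) z y = hermForm G z y := fun z y =>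
    Fintype.sum_equiv e _ _ fun i => rfl
  have h2 : ∀ y, wordWeight (G.submatrix e id) y = wordWeight G y := fun y => by
    simp only [wordWeight, hammingNorm, Finset.card_filter]
    exact Fintype.sum_equiv e _ _ fun i => rfl
  exact ⟨G.submatrix e id, by simpa only [Nondeg, h1] using hG, by simpa only [h2] using h⟩

/-- Changing the multiplicities by a function of total `w` whose sums off the lines are even and
at least `e`. -/
theorem Attains.add_mult {n d : ℕ} (h : Attains F n d) (hF : Nat.card F = 4) (f : Pt F → ℕ)
    {w e : ℕ} (hw : ∑ p, f p = w) (he : ∀ q, (e : ℤ) ≤ avoidSum (fun p => (f p : ℤ)) q)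
    (heven : ∀ q, 2 ∣ avoidSum (fun p => (f p : ℤ)) q) : Attains F (n + w) (d + e) := by
  classical
  obtain ⟨G, hG, hd⟩ := h
  obtain ⟨E, -, hE⟩ := exists_mult_eq f hw
  have h1 := wordWeight_fromRows G E
  have h2 : ∀ y, 2 ∣ wordWeight E y ∧ (y ≠ 0 → e ≤ wordWeight E y) := by
    intro y
    by_cases hy : y = 0
    · simp [hy, wordWeight_zero]
    · obtain ⟨a, ha⟩ := Projectivization.exists_smul_eq_mk_rep F y hy
      have h3 := wordWeight_rep E (Projectivization.mk F y hy)
      rw [← ha, wordWeight_smul, hE] at h3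
      have h4 := he (Projectivization.mk F y hy)
      have h5 := heven (Projectivization.mk F y hy)
      rw [← h3] at h4 h5
      exact ⟨by exact_mod_cast h5, fun _ => by exact_mod_cast h4⟩
  refine Attains.of_matrix (fromRows G E) (by simp) ((nondeg_congr hF fun y => ?_).1 hG) ?_
  · have := (h2 y).1
    rw [h1]
    omega
  · intro y hy
    rw [h1]
    exact add_le_add (hd y hy) ((h2 y).2 hy)

theorem Attains.add_plane {n d : ℕ} (h : Attains F n d) (hF : Nat.card F = 4) (k : ℕ) :
    Attains F (n + 21 * k) (d + 16 * k) := by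
  refine h.add_mult hF (fun _ => k) (by simp [card_pt hF]) (fun q => ?_) fun q => ?_
  · rw [avoidSum_const hF]
    push_cast
    exact le_rfl
  · rw [avoidSum_const hF]
    omega

/-- Adding the `16` points of an affine plane. -/
theorem Attains.add_affine {n d : ℕ} (h : Attains F n d) (hF : Nat.card F = 4) (j : ℕ) :
    Attains F (n + 16 * j) (d + 12 * j) := by
  classical
  obtain ⟨l⟩ : Nonempty (Pt F) := Fintype.card_pos_iff.1 (by rw [card_pt hF]; norm_num)
  have hcast : ∀ p : Pt F, ((j * (avoid p l).toNat : ℕ) : ℤ) = j * avoid p l := by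
    intro p
    rw [avoid]
    split_ifs <;> simp
  have hsum : ∀ q, avoidSum (fun p => ((j * (avoid p l).toNat : ℕ) : ℤ)) q
      = j * (12 + if q = l then 4 else 0) := by
    intro q
    simp only [hcast]
    rw [avoidSum_mul_left, ← sum_avoid_mul_avoid hF, avoidSum]
    exact congrArg _ (Finset.sum_congr rfl fun p _ => by rw [avoid_comm])
  refine h.add_mult hF (fun p => j * (avoid p l).toNat) ?_ (fun q => ?_) fun q => ?_
  · have h1 : ((∑ p : Pt F, j * (avoid p l).toNat : ℕ) : ℤ) = ((16 * j : ℕ) : ℤ) := by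
      rw [Nat.cast_sum]
      simp only [hcast, ← Finset.mul_sum, sum_avoid hF]
      push_cast
      ring
    exact Nat.cast_injective h1
  · rw [hsum]
    push_cast
    split_ifs <;> nlinarith
  · rw [hsum]
    split_ifs
    · exact ⟨j * 8, by ring⟩
    · exact ⟨j * 6, by ring⟩

/-- The points `S` are added to `k` copies of the plane, and the points `T` removed. The plane has
even weights and the characteristic is `2`, so the Hermitian form is the sum of those of `S` and
`T`. -/
theorem Attains.of_anticode (hF : Nat.card F = 4) {ι κ : Type*} [Fintype ι] [Fintype κ]
    (T : Matrix ι (Fin 3) F) (S : Matrix κ (Fin 3) F) (hT : ∀ i, T i ≠ 0) (hS : ∀ i, S i ≠ 0)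
    {n d k : ℕ} (hn : n + Fintype.card ι = 21 * k + Fintype.card κ) (hk : ∀ p, mult T p ≤ k)
    (hnd : ∀ z, (∀ y, hermForm T z y + hermForm S z y = 0) → z = 0)
    (hd : ∀ y ≠ 0, d + wordWeight T y ≤ 16 * k + wordWeight S y) : Attains F n d := by
  have hsumT := sum_mult_of_ne_zero T hT
  have hsumS := sum_mult_of_ne_zero S hS
  obtain ⟨G, -, hG⟩ := exists_mult_eq (n := n) (fun p => (k - mult T p) + mult S p) (by
    have h1 : ∑ p : Pt F, (k - mult T p) + ∑ p, mult T p = 21 * k := by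
      rw [← Finset.sum_add_distrib, Finset.sum_congr rfl fun p _ => Nat.sub_add_cancel (hk p)]
      simp [card_pt hF]
    rw [Finset.sum_add_distrib]
    omega)
  have hw : ∀ y ≠ 0, wordWeight G y + wordWeight T y = 16 * k + wordWeight S y := by
    intro y hy
    obtain ⟨a, ha⟩ := Projectivization.exists_smul_eq_mk_rep F y hy
    have h1 := wordWeight_rep G (Projectivization.mk F y hy)
    have h2 := wordWeight_rep T (Projectivization.mk F y hy)
    have h3 := wordWeight_rep S (Projectivization.mk F y hy)
    rw [← ha, wordWeight_smul] at h1 h2 h3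
    have h4 : (fun p => (mult G p : ℤ)) = fun p => ((k : ℤ) - mult T p) + mult S p := by
      funext p
      rw [hG]
      have := hk p
      push_cast [Nat.cast_sub this]
      ring
    rw [h4, avoidSum_add, avoidSum_sub, avoidSum_const hF] at h1
    omega
  have h1 := wordWeight_fromRows T S
  have h2 : ∀ z y, hermForm (fromRows T S) z y = hermForm T z y + hermForm S z y := fun z y => by
    simp only [hermForm, fromRows_mulVec, Fintype.sum_sum_type, Sum.elim_inl, Sum.elim_inr]
  refine ⟨G, (nondeg_congr hF (G := fromRows T S) fun y => ?_).1 ?_, fun y hy => ?_⟩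
  · rw [h1]
    by_cases hy : y = 0
    · simp [hy, wordWeight_zero]
    · have := hw y hy
      omega
  · simpa only [Nondeg, h2] using hnd
  · have := hw y hy
    have := hd y hy
    omega

theorem mult_le_one {ι : Type*} [Fintype ι] (T : Matrix ι (Fin 3) F)
    (h : ∀ i j (a : Fˣ), T i = a • T j → i = j) (p : Pt F) : mult T p ≤ 1 := by
  classical
  rw [mult, Finset.card_le_one]
  intro i hi j hj
  obtain ⟨a, ha⟩ := (Finset.mem_filter.1 hi).2
  obtain ⟨b, hb⟩ := (Finset.mem_filter.1 hj).2
  refine h i j (a * b⁻¹) ?_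
  rw [← ha, ← hb, smul_smul]
  simp

theorem hermForm_empty (S : Matrix (Fin 0) (Fin 3) F) (z y : Fin 3 → F) : hermForm S z y = 0 := by
  simp [hermForm]

theorem wordWeight_le_card {ι : Type*} [Fintype ι] (G : Matrix ι (Fin 3) F) (y : Fin 3 → F) :
    wordWeight G y ≤ Fintype.card ι := hammingNorm_le_card_fintype

/-- The plane without the vertices of a triangle. -/
theorem attains_18_13 (hF : Nat.card F = 4) : Attains F 18 13 := by
  refine Attains.of_anticode hF (k := 1) (1 : Matrix (Fin 3) (Fin 3) F)
    (0 : Matrix (Fin 0) (Fin 3) F) (fun i h => ?_) (fun i => i.elim0) (by simp)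
    (mult_le_one _ fun i j a h => ?_) (fun z hz => ?_) (fun y _ => ?_)
  · have := congrFun h i
    simp at this
  · have := congrFun h i
    by_contra hij
    simp [Ne.symm hij] at this
  · ext k
    have := hz (Pi.single k 1)
    rw [hermForm_empty, add_zero, hermForm, Finset.sum_eq_single k] at this
    · simpa using this
    · intro b _ hb
      simp [hb]
    · simp
  · have := wordWeight_le_card (1 : Matrix (Fin 3) (Fin 3) F) y
    simp at this
    omega

/-- The plane without three points of a line and one further point. -/
theorem attains_17_12 (hF : Nat.card F = 4) : Attains F 17 12 := by
  have := charP_two hF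
  have h2 := CharTwo.two_eq_zero (R := F)
  let T : Matrix (Fin 4) (Fin 3) F := !![1, 0, 0; 0, 1, 0; 1, 1, 0; 0, 0, 1]
  refine Attains.of_anticode hF (k := 1) T
    (0 : Matrix (Fin 0) (Fin 3) F) (fun i h => ?_) (fun i => i.elim0) (by simp)
    (mult_le_one _ fun i j a h => ?_) (fun z hz => ?_) (fun y _ => ?_)
  · have h0 := congrFun h 0
    have h1 := congrFun h 1
    have h2 := congrFun h 2
    fin_cases i <;> simp [T] at h0 h1 h2
  · have h0 := congrFun h 0
    have h1 := congrFun h 1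
    have h2 := congrFun h 2
    fin_cases i <;> fin_cases j <;> simp [T, Units.smul_def] at h0 h1 h2 ⊢
    · exact a.ne_zero h1.symm
    · exact a.ne_zero h0.symm
  · have hT : ∀ y, hermForm T z y
        = z 0 * y 0 ^ 2 + z 1 * y 1 ^ 2 + (z 0 + z 1) * (y 0 + y 1) ^ 2 + z 2 * y 2 ^ 2 := by
      intro y
      simp [hermForm, T, Fin.sum_univ_succ, mulVec, dotProduct]
      ring
    simp only [hermForm_empty, add_zero, hT] at hz
    have h0 := hz ![1, 0, 0]
    have h1 := hz ![0, 1, 0]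
    have h3 := hz ![0, 0, 1]
    simp at h0 h1 h3
    ext k
    fin_cases k
    · change z 0 = 0
      linear_combination h1 - z 1 * h2
    · change z 1 = 0
      linear_combination h0 - z 0 * h2
    · exact h3
  · have := wordWeight_le_card T y
    simp at this
    omega

/-- The points `(1, f a, g b)`. -/
def grid {α β : Type*} (f : α → F) (g : β → F) : Matrix (α × β) (Fin 3) F :=
  fun x => ![1, f x.1, g x.2]

section Grid

variable {α β : Type*} [Fintype α] [Fintype β] {f : α → F} {g : β → F}

theorem grid_ne_zero (x : α × β) : grid f g x ≠ 0 := fun h => by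
  have := congrFun h 0
  simp [grid] at this

theorem grid_mulVec (y : Fin 3 → F) (x : α × β) :
    (grid f g *ᵥ y) x = y 0 + f x.1 * y 1 + g x.2 * y 2 := by
  simp [grid, mulVec, dotProduct, Fin.sum_univ_succ]
  ring

/-- The number of zeros of a codeword is bounded by mapping them injectively to `γ`. -/
theorem card_le_wordWeight_grid_add (y : Fin 3 → F) {γ : Type*} [Fintype γ] (φ : α × β → γ)
    (h : ∀ x x', y 0 + f x.1 * y 1 + g x.2 * y 2 = 0 → y 0 + f x'.1 * y 1 + g x'.2 * y 2 = 0 →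
      φ x = φ x' → x = x') :
    Fintype.card α * Fintype.card β ≤ wordWeight (grid f g) y + Fintype.card γ := by
  classical
  have h1 : (Finset.univ.filter fun x => (grid f g *ᵥ y) x = 0).card ≤ Fintype.card γ := by
    refine Finset.card_le_card_of_injOn φ (fun _ _ => Finset.mem_coe.2 (Finset.mem_univ _)) ?_
    intro x hx x' hx' hxx
    refine h x x' ?_ ?_ hxx
    · rw [← grid_mulVec]
      exact (Finset.mem_filter.1 hx).2
    · rw [← grid_mulVec]
      exact (Finset.mem_filter.1 hx').2
  have h2 := Finset.card_filter_add_card_filter_not (s := Finset.univ)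
    fun x => (grid f g *ᵥ y) x = 0
  rw [Finset.card_univ, Fintype.card_prod] at h2
  have h3 : wordWeight (grid f g) y
      = (Finset.univ.filter fun x => ¬ (grid f g *ᵥ y) x = 0).card := rfl
  omega

theorem card_le_wordWeight_grid_of_two (hg : Function.Injective g) {y : Fin 3 → F} (hy : y 2 ≠ 0) :
    Fintype.card α * Fintype.card β ≤ wordWeight (grid f g) y + Fintype.card α := by
  refine card_le_wordWeight_grid_add y Prod.fst fun x x' hx hx' h => Prod.ext h (hg ?_)
  rw [h] at hx
  exact mul_right_cancel₀ hy (add_left_cancel (hx.trans hx'.symm))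

theorem card_le_wordWeight_grid_of_one (hf : Function.Injective f) {y : Fin 3 → F} (hy : y 1 ≠ 0)
    (hy2 : y 2 = 0) :
    Fintype.card α * Fintype.card β ≤ wordWeight (grid f g) y + Fintype.card β := by
  refine card_le_wordWeight_grid_add y Prod.snd fun x x' hx hx' h => Prod.ext (hf ?_) h
  simp only [hy2, mul_zero, add_zero] at hx hx'
  exact mul_right_cancel₀ hy (add_left_cancel (hx.trans hx'.symm))

theorem card_le_wordWeight_grid_of_zero {y : Fin 3 → F} (hy : y ≠ 0) (hy1 : y 1 = 0)
    (hy2 : y 2 = 0) : Fintype.card α * Fintype.card β ≤ wordWeight (grid f g) y := by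
  have h0 : y 0 ≠ 0 := fun h0 => hy (by
    ext k
    fin_cases k <;> assumption)
  have h1 : wordWeight (grid f g) y
      = (Finset.univ.filter fun x => (grid f g *ᵥ y) x ≠ 0).card := rfl
  rw [h1, Finset.filter_true_of_mem fun x _ => by simp [grid_mulVec, hy1, hy2, h0],
    Finset.card_univ, Fintype.card_prod]

theorem hermForm_grid_zero (hg : ∑ b, g b = 0) (z : Fin 3 → F) :
    hermForm (grid f g) z ![1, 0, 0]
      = Fintype.card α * Fintype.card β * z 0 + Fintype.card β * (∑ a, f a) * z 1 := by
  have : ∀ x : α × β, (grid f g *ᵥ z) x * (grid f g *ᵥ ![1, 0, 0]) x ^ 2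
      = (z 0 + f x.1 * z 1) + g x.2 * z 2 := fun x => by simp [grid_mulVec]
  simp only [hermForm, this, Fintype.sum_prod_type, Finset.sum_add_distrib, ← Finset.sum_mul, hg]
  simp [← Finset.mul_sum]
  ring

theorem hermForm_grid_one (hF : Nat.card F = 4) (hf : ∀ a, f a ≠ 0) (hg : ∑ b, g b = 0)
    (z : Fin 3 → F) : hermForm (grid f g) z ![0, 1, 0]
      = Fintype.card β * (∑ a, f a ^ 2) * z 0 + Fintype.card α * Fintype.card β * z 1 := by
  have : ∀ x : α × β, (grid f g *ᵥ z) x * (grid f g *ᵥ ![0, 1, 0]) x ^ 2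
      = (f x.1 ^ 2 * z 0 + z 1) + g x.2 * (f x.1 ^ 2 * z 2) := fun x => by
    simp only [grid_mulVec, cons_val]
    linear_combination z 1 * pow_three hF (hf x.1)
  simp only [hermForm, this, Fintype.sum_prod_type, Finset.sum_add_distrib, ← Finset.sum_mul, hg]
  simp [← Finset.mul_sum]
  ring

theorem hermForm_grid_two (hF : Nat.card F = 4) (hg0 : ∀ b, g b ≠ 0) (hg : ∑ b, g b ^ 2 = 0)
    (z : Fin 3 → F) : hermForm (grid f g) z ![0, 0, 1]
      = Fintype.card α * Fintype.card β * z 2 := by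
  have : ∀ x : α × β, (grid f g *ᵥ z) x * (grid f g *ᵥ ![0, 0, 1]) x ^ 2
      = g x.2 ^ 2 * (z 0 + f x.1 * z 1) + z 2 := fun x => by
    simp only [grid_mulVec, cons_val]
    linear_combination z 2 * pow_three hF (hg0 x.2)
  simp only [hermForm, this, Fintype.sum_prod_type, Finset.sum_add_distrib, ← Finset.sum_mul, hg]
  simp
  ring

end Grid

theorem sum_units_pow (hF : Nat.card F = 4) [Fintype Fˣ] (i : ℕ) :
    ∑ u : Fˣ, (u : F) ^ i = if 3 ∣ i then 1 else 0 := by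
  have := charP_two hF
  have := Fintype.ofFinite F
  have h := FiniteField.sum_pow_units F i
  rw [← Nat.card_eq_fintype_card (α := F), hF] at h
  rw [← CharTwo.neg_eq (1 : F)]
  convert h

theorem card_units_eq (hF : Nat.card F = 4) [Fintype Fˣ] : Fintype.card Fˣ = 3 := by
  have := Fintype.ofFinite F
  rw [← Nat.card_eq_fintype_card, Nat.card_units, hF]

/-- The nine points `(1, a, b)` with `a` and `b` non-zero. -/
theorem attains_9_6 (hF : Nat.card F = 4) : Attains F 9 6 := by
  have := charP_two hF
  have h2 := CharTwo.two_eq_zero (R := F)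
  have := Fintype.ofFinite Fˣ
  have hc := card_units_eq hF
  let S := grid (fun a : Fˣ => (a : F)) (fun b : Fˣ => (b : F))
  refine Attains.of_matrix S (by simp [hc]) (fun z hz => ?_) (fun y hy => ?_)
  · have e1 : ∑ u : Fˣ, (u : F) = 0 := by simpa using sum_units_pow hF 1
    have e2 : ∑ u : Fˣ, (u : F) ^ 2 = 0 := by simpa using sum_units_pow hF 2
    have h0 := hz ![1, 0, 0]
    have h1 := hz ![0, 1, 0]
    have h3 := hz ![0, 0, 1]
    rw [hermForm_grid_zero e1, hc, e1] at h0
    rw [hermForm_grid_one hF Units.ne_zero e1, hc, e2] at h1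
    rw [hermForm_grid_two hF Units.ne_zero e2, hc] at h3
    push_cast at h0 h1 h3
    ext k
    fin_cases k
    · change z 0 = 0
      linear_combination h0 - 4 * z 0 * h2
    · change z 1 = 0
      linear_combination h1 - 4 * z 1 * h2
    · change z 2 = 0
      linear_combination h3 - 4 * z 2 * h2
  · have hi : Function.Injective (fun a : Fˣ => (a : F)) := Units.val_injective
    by_cases hy2 : y 2 = 0
    · by_cases hy1 : y 1 = 0
      · have := card_le_wordWeight_grid_of_zero (f := fun a : Fˣ => (a : F))
          (g := fun b : Fˣ => (b : F)) hy hy1 hy2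
        rw [hc] at this
        exact le_trans (by norm_num) this
      · have := card_le_wordWeight_grid_of_one (g := fun b : Fˣ => (b : F)) hi hy1 hy2
        rw [hc] at this
        exact Nat.le_of_add_le_add_right this
    · have := card_le_wordWeight_grid_of_two (f := fun b : Fˣ => (b : F)) hi hy2
      rw [hc] at this
      exact Nat.le_of_add_le_add_right this

/-- The plane without a point, together with the six points `(1, a, b)` with `a` and `b` non-zero
and `a ≠ 1`. -/
theorem attains_26_19 (hF : Nat.card F = 4) : Attains F 26 19 := by
  classical
  have := charP_two hF
  have h2 := CharTwo.two_eq_zero (R := F)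
  have := Fintype.ofFinite Fˣ
  have hc := card_units_eq hF
  have hc2 : Fintype.card {a : Fˣ // a ≠ 1} = 2 := by simp [hc]
  let f : {a : Fˣ // a ≠ 1} → F := fun a => (a : Fˣ)
  let g : Fˣ → F := fun b => b
  have hf : Function.Injective f := Units.val_injective.comp Subtype.val_injective
  have hg : Function.Injective g := Units.val_injective
  have hsub : ∀ φ : Fˣ → F, ∑ a : {a : Fˣ // a ≠ 1}, φ a = ∑ a, φ a - φ 1 := by
    intro φ
    rw [← Finset.sum_subtype (Finset.univ.erase 1) (p := fun a => a ≠ 1) (by simp) φ,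
      ← Finset.sum_erase_add _ _ (Finset.mem_univ (1 : Fˣ))]
    ring
  let T : Matrix (Fin 1) (Fin 3) F := !![0, 0, 1]
  have hT : ∀ y i, (T *ᵥ y) i = y 2 := fun y i => by
    simp [T, mulVec, dotProduct, Fin.sum_univ_succ]
  refine Attains.of_anticode hF (k := 1) T (grid f g) (fun i h => ?_) grid_ne_zero
    (by simp [hc, hc2]) (mult_le_one _ fun i j _ _ => Subsingleton.elim i j)
    (fun z hz => ?_) (fun y hy => ?_)
  · have := congrFun h 2
    simp [T] at this
  · have e1 : ∑ u : Fˣ, (u : F) = 0 := by simpa using sum_units_pow hF 1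
    have e2 : ∑ u : Fˣ, (u : F) ^ 2 = 0 := by simpa using sum_units_pow hF 2
    have e3 : ∑ a, f a = -1 := by
      rw [hsub fun u => (u : F), e1]
      simp
    have e4 : ∑ a, f a ^ 2 = -1 := by
      rw [hsub fun u => (u : F) ^ 2, e2]
      simp
    have h0 := hz ![1, 0, 0]
    have h1 := hz ![0, 1, 0]
    have h3 := hz ![0, 0, 1]
    rw [hermForm_grid_zero e1, hc, hc2, e3, hermForm] at h0
    rw [hermForm_grid_one hF (fun a => Units.ne_zero _) e1, hc, hc2, e4, hermForm] at h1
    rw [hermForm_grid_two hF Units.ne_zero e2, hc, hc2, hermForm] at h3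
    simp [hT] at h0 h1 h3
    ext k
    fin_cases k
    · change z 0 = 0
      linear_combination h1 + (2 * z 0 - 3 * z 1) * h2
    · change z 1 = 0
      linear_combination h0 + (2 * z 1 - 3 * z 0) * h2
    · change z 2 = 0
      linear_combination h3 - 3 * z 2 * h2
  · by_cases hy2 : y 2 = 0
    · have hT0 : wordWeight T y = 0 := by
        rw [wordWeight, hammingNorm_eq_zero]
        ext i
        rw [hT, hy2]
        rfl
      by_cases hy1 : y 1 = 0
      · have := card_le_wordWeight_grid_of_zero (f := f) (g := g) hy hy1 hy2
        rw [hc, hc2] at this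
        omega
      · have := card_le_wordWeight_grid_of_one (g := g) hf hy1 hy2
        rw [hc, hc2] at this
        omega
    · have h1 := card_le_wordWeight_grid_of_two (f := f) hg hy2
      have h3 := wordWeight_le_card T y
      rw [hc, hc2] at h1
      rw [Fintype.card_fin] at h3
      omega

/-- The four codes above have `16 n - 21 d = 15, 20, 18, 17`, and affine planes contribute `4`
each; so all tabulated values occur. -/
theorem exists_attains (hF : Nat.card F = 4) (t : Fin 21) (s : ℕ) (hs : sTable t ≤ s) :
    ∃ d : ℕ, (d : ℤ) = 16 * s + alphaTable t ∧ Attains F (21 * s + t) d := by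
  have key : ∀ (n₀ d₀ j c : ℕ) (a : ℤ) (τ : ℕ), Attains F n₀ d₀ → n₀ + 16 * j = 21 * c + τ →
      (d₀ : ℤ) + 12 * j = 16 * c + a → c ≤ s →
      ∃ d : ℕ, (d : ℤ) = 16 * s + a ∧ Attains F (21 * s + τ) d := by
    intro n₀ d₀ j c a τ h hn hd hc
    obtain ⟨k, rfl⟩ := Nat.exists_eq_add_of_le hc
    refine ⟨d₀ + 12 * j + 16 * k, ?_, ?_⟩
    · push_cast
      linarith
    · have := (h.add_affine hF j).add_plane hF k
      convert this using 1
      omega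
  have hA := attains_18_13 hF
  have hB := attains_17_12 hF
  have hC := attains_9_6 hF
  have hD := attains_26_19 hF
  fin_cases t
  · exact key _ _ 1 2 _ 0 hD (by norm_num) (by norm_num [alphaTable]) (le_trans (by decide) hs)
  · exact key _ _ 5 5 _ 1 hD (by norm_num) (by norm_num [alphaTable]) (le_trans (by decide) hs)
  · exact key _ _ 3 3 _ 2 hB (by norm_num) (by norm_num [alphaTable]) (le_trans (by decide) hs)
  · exact key _ _ 3 3 _ 3 hA (by norm_num) (by norm_num [alphaTable]) (le_trans (by decide) hs)
  · exact key _ _ 1 1 _ 4 hC (by norm_num) (by norm_num [alphaTable]) (le_trans (by decide) hs)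
  · exact key _ _ 0 1 _ 5 hD (by norm_num) (by norm_num [alphaTable]) (le_trans (by decide) hs)
  · exact key _ _ 4 4 _ 6 hD (by norm_num) (by norm_num [alphaTable]) (le_trans (by decide) hs)
  · exact key _ _ 2 2 _ 7 hB (by norm_num) (by norm_num [alphaTable]) (le_trans (by decide) hs)
  · exact key _ _ 2 2 _ 8 hA (by norm_num) (by norm_num [alphaTable]) (le_trans (by decide) hs)
  · exact key _ _ 0 0 _ 9 hC (by norm_num) (by norm_num [alphaTable]) (le_trans (by decide) hs)
  · exact key _ _ 4 3 _ 10 hC (by norm_num) (by norm_num [alphaTable]) (le_trans (by decide) hs)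
  · exact key _ _ 3 3 _ 11 hD (by norm_num) (by norm_num [alphaTable]) (le_trans (by decide) hs)
  · exact key _ _ 1 1 _ 12 hB (by norm_num) (by norm_num [alphaTable]) (le_trans (by decide) hs)
  · exact key _ _ 1 1 _ 13 hA (by norm_num) (by norm_num [alphaTable]) (le_trans (by decide) hs)
  · exact key _ _ 5 4 _ 14 hA (by norm_num) (by norm_num [alphaTable]) (le_trans (by decide) hs)
  · exact key _ _ 3 2 _ 15 hC (by norm_num) (by norm_num [alphaTable]) (le_trans (by decide) hs)
  · exact key _ _ 2 2 _ 16 hD (by norm_num) (by norm_num [alphaTable]) (le_trans (by decide) hs)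
  · exact key _ _ 0 0 _ 17 hB (by norm_num) (by norm_num [alphaTable]) (le_trans (by decide) hs)
  · exact key _ _ 0 0 _ 18 hA (by norm_num) (by norm_num [alphaTable]) (le_trans (by decide) hs)
  · exact key _ _ 4 3 _ 19 hA (by norm_num) (by norm_num [alphaTable]) (le_trans (by decide) hs)
  · exact key _ _ 2 1 _ 20 hC (by norm_num) (by norm_num [alphaTable]) (le_trans (by decide) hs)
end Existence

/-! ### The largest minimum weight and the correspondence of codes -/

section Correspondence

variable {F : Type*} [Field F] [Finite F] [DecidableEq F]

/-- Replacing `d` by `d + 1` lowers `16 n - 21 d` by `21`. Hence `d` is optimal if `16 n - 21 d` is at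
most `37`, unless it is `36`, as `excess_bound_of_nondeg` excludes values below `15` and the value
`16`, but not `15`. -/
theorem largestMinWeight_eq (hF : Nat.card F = 4) {n d : ℕ} (hd0 : 0 < d) (h : Attains F n d)
    (h1 : 16 * n ≤ 21 * d + 37) (h2 : 16 * n ≠ 21 * d + 36) : largestMinWeight F n 3 = d := by
  have hub : ∀ e ∈ {d : ℕ | ∃ C : Submodule F (Fin n → F), IsCode C 3 d ∧ IsHermitianLCD C},
      e ≤ d := by
    rintro e ⟨C, hC, hlcd⟩
    obtain ⟨G, hG, rfl⟩ := exists_generator hC.1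
    have h3 := excess_bound_of_nondeg hF G ((isHermitianLCD_range_iff hG).1 hlcd)
      ((isCode_range_iff hG e).1 hC).2
    rw [Fintype.card_fin] at h3
    omega
  obtain ⟨G, hnd, hd⟩ := h
  have hG : Function.Injective G.mulVec := injective_of_pos fun y hy => hd0.trans_le (hd y hy)
  -- the minimum weight of the code of `G` is attained, and it is not larger than `d`
  have hmin : ∃ e, IsCode (LinearMap.range G.mulVecLin) 3 e ∧ d ≤ e := by
    have hne : ∃ w, ∃ y : Fin 3 → F, y ≠ 0 ∧ wordWeight G y = w := by
      obtain ⟨y, hy⟩ := exists_ne (0 : Fin 3 → F)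
      exact ⟨_, y, hy, rfl⟩
    classical
    obtain ⟨y, hy, hw⟩ := Nat.find_spec hne
    refine ⟨Nat.find hne, (isCode_range_iff hG _).2 ⟨⟨y, hy, hw⟩, fun z hz => ?_⟩, ?_⟩
    · exact Nat.find_min' hne ⟨z, hz, rfl⟩
    · rw [← hw]
      exact hd y hy
  obtain ⟨e, hC, hde⟩ := hmin
  have hmem : e ∈ {d : ℕ | ∃ C : Submodule F (Fin n → F), IsCode C 3 d ∧ IsHermitianLCD C} :=
    ⟨_, hC, (isHermitianLCD_range_iff hG).2 hnd⟩
  obtain rfl := le_antisymm hde (hub e hmem)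
  exact IsGreatest.csSup_eq ⟨hmem, hub⟩

/-- `G` generates a Hermitian LCD code of dimension `3`, minimum weight `d > 0` and dual distance
at least `2`. -/
def IsLCDGenerator {n : ℕ} (G : Matrix (Fin n) (Fin 3) F) (d : ℕ) : Prop :=
  ((∃ y ≠ 0, wordWeight G y = d) ∧ ∀ y ≠ 0, d ≤ wordWeight G y) ∧ Nondeg G ∧ ∀ i, G i ≠ 0

theorem IsLCDGenerator.injective {n d : ℕ} {G : Matrix (Fin n) (Fin 3) F} (h : IsLCDGenerator G d)
    (hd : 0 < d) : Function.Injective G.mulVec :=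
  injective_of_pos fun y hy => hd.trans_le (h.1.2 y hy)

theorem IsLCDGenerator.range {n d : ℕ} {G : Matrix (Fin n) (Fin 3) F} (h : IsLCDGenerator G d)
    (hd : 0 < d) : IsCode (LinearMap.range G.mulVecLin) 3 d ∧
      IsHermitianLCD (LinearMap.range G.mulVecLin) ∧
      DualDistanceGeTwo (LinearMap.range G.mulVecLin) :=
  ⟨(isCode_range_iff (h.injective hd) d).2 h.1, (isHermitianLCD_range_iff (h.injective hd)).2 h.2.1,
    (dualDistanceGeTwo_range_iff G).2 h.2.2⟩

theorem exists_isLCDGenerator {n d : ℕ} (C : LCDCode F n 3 d) :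
    ∃ G : Matrix (Fin n) (Fin 3) F, IsLCDGenerator G d ∧ LinearMap.range G.mulVecLin = C.1 := by
  obtain ⟨C, hC, hlcd, hdual⟩ := C
  obtain ⟨G, hG, rfl⟩ := exists_generator hC.1
  exact ⟨G, ⟨(isCode_range_iff hG d).1 hC, (isHermitianLCD_range_iff hG).1 hlcd,
    (dualDistanceGeTwo_range_iff G).1 hdual⟩, rfl⟩

theorem isLCDGenerator_iff_of_mult_add (hF : Nat.card F = 4) {n n' d k : ℕ}
    {G : Matrix (Fin n) (Fin 3) F} {G' : Matrix (Fin n') (Fin 3) F}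
    (h0 : ∀ i, G i ≠ 0) (h0' : ∀ i, G' i ≠ 0) (h : ∀ p, mult G' p = mult G p + k) :
    IsLCDGenerator G d ↔ IsLCDGenerator G' (d + 16 * k) := by
  have hw : ∀ y ≠ 0, wordWeight G' y = wordWeight G y + 16 * k := fun y hy =>
    wordWeight_of_mult_add hF G G' k h hy
  refine and_congr (and_congr ?_ ?_)
    (and_congr (nondeg_iff_of_mult_add hF G G' k h) (iff_of_true h0 h0'))
  · refine exists_congr fun y => and_congr_right fun hy => ?_
    rw [hw y hy, add_left_inj]
  · refine forall₂_congr fun y hy => ?_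
    rw [hw y hy, add_le_add_iff_right]

/-- A relation which is total on both sides and compatible with the equivalences induces a
bijection of the quotients. -/
theorem nonempty_quotient_equiv {α β : Type*} [sα : Setoid α] [sβ : Setoid β] (R : α → β → Prop)
    (hl : ∀ a, ∃ b, R a b) (hr : ∀ b, ∃ a, R a b)
    (hR : ∀ a b a' b', R a b → R a' b' → (a ≈ a' ↔ b ≈ b')) :
    Nonempty (Quotient sα ≃ Quotient sβ) := by
  choose f hf using hl
  refine ⟨Equiv.ofBijective
    (Quotient.map f fun a a' h => (hR _ _ _ _ (hf a) (hf a')).1 h) ⟨?_, ?_⟩⟩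
  · rintro ⟨a⟩ ⟨a'⟩ h
    exact Quotient.sound ((hR _ _ _ _ (hf a) (hf a')).2 (Quotient.exact h))
  · rintro ⟨b⟩
    obtain ⟨a, ha⟩ := hr b
    exact ⟨⟦a⟧, Quotient.sound ((hR _ _ _ _ (hf a) ha).1 (Setoid.refl a))⟩

/-- If `3 n ≤ 4 d`, every point occurs at least `k` times in a code with the larger parameters,
so that adding `k` copies of the plane is a bijection. -/
theorem nonempty_lcdClasses_equiv (hF : Nat.card F = 4) {n d : ℕ} (k : ℕ) (hd : 0 < d)
    (hnd : 3 * n ≤ 4 * d) :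
    Nonempty (LCDClasses F n 3 d ≃ LCDClasses F (n + 21 * k) 3 (d + 16 * k)) := by
  have hd' : 0 < d + 16 * k := by omega
  refine nonempty_quotient_equiv (fun (C : LCDCode F n 3 d)
    (D : LCDCode F (n + 21 * k) 3 (d + 16 * k)) => ∃ G G', IsLCDGenerator G d ∧
      IsLCDGenerator G' (d + 16 * k) ∧ LinearMap.range G.mulVecLin = C.1 ∧
      LinearMap.range G'.mulVecLin = D.1 ∧ ∀ p, mult G' p = mult G p + k) ?_ ?_ ?_
  · intro C
    obtain ⟨G, hG, hC⟩ := exists_isLCDGenerator C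
    have hsum := sum_mult_of_ne_zero G hG.2.2
    obtain ⟨G', h0, hm⟩ := exists_mult_eq (n := n + 21 * k) (fun p => mult G p + k) (by
      rw [Finset.sum_add_distrib, hsum]
      simp [card_pt hF])
    have hm' : ∀ p, mult G' p = mult G p + k := fun p => by rw [hm]
    have hG' := (isLCDGenerator_iff_of_mult_add hF hG.2.2 h0 hm').1 hG
    exact ⟨⟨_, hG'.range hd'⟩, G, G', hG, hG', hC, rfl, hm'⟩
  · intro D
    obtain ⟨G', hG', hD⟩ := exists_isLCDGenerator D
    have hsum := sum_mult_of_ne_zero G' hG'.2.2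
    have hk : ∀ p, k ≤ mult G' p := fun p => by
      have := le_mult hF G' hG'.2.2 hG'.1.2 p
      rw [Fintype.card_fin] at this
      omega
    obtain ⟨G, h0, hm⟩ := exists_mult_eq (n := n) (fun p => mult G' p - k) (by
      have h1 : ∑ p : Pt F, (mult G' p - k) + 21 * k = n + 21 * k := by
        rw [Fintype.card_fin] at hsum
        refine Eq.trans ?_ hsum
        rw [← Finset.sum_congr rfl fun p _ => Nat.sub_add_cancel (hk p), Finset.sum_add_distrib]
        simp [card_pt hF]
      omega)
    have hm' : ∀ p, mult G' p = mult G p + k := fun p => by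
      rw [hm]
      exact (Nat.sub_add_cancel (hk p)).symm
    have hG := (isLCDGenerator_iff_of_mult_add hF h0 hG'.2.2 hm').2 hG'
    exact ⟨⟨_, hG.range hd⟩, G, G', hG, hG', rfl, hD, hm'⟩
  · rintro ⟨C, hC⟩ ⟨D, hD⟩ ⟨C₁, hC₁⟩ ⟨D₁, hD₁⟩ ⟨G, G', hG, hG', hGC, hGD, hm⟩
      ⟨G₁, G₁', hG₁, hG₁', hGC₁, hGD₁, hm₁⟩
    subst hGC hGD hGC₁ hGD₁
    change CodeEquiv _ _ ↔ CodeEquiv _ _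
    rw [codeEquiv_range_iff (hG₁.injective hd) hG.2.2 hG₁.2.2,
      codeEquiv_range_iff (hG₁'.injective hd') hG'.2.2 hG₁'.2.2, funext hm, funext hm₁,
      projEquiv_add_iff]

end Correspondence

end QuaternaryLCD

theorem mainTheorem7 {F : Type*} [Field F] [DecidableEq F] (hF : Nat.card F = 4)
    (t : Fin 21) (s : ℕ) (hs : QuaternaryLCD.sTable t ≤ s) :
    (QuaternaryLCD.largestMinWeight F (21 * s + t) 3 : ℤ)
        = 16 * (s : ℤ) + QuaternaryLCD.alphaTable t ∧
    QuaternaryLCD.rParam (21 * s + t) 3 (QuaternaryLCD.largestMinWeight F (21 * s + t) 3)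
        = (QuaternaryLCD.rTable t : ℤ) ∧
    QuaternaryLCD.sParam (21 * s + t) 3 (QuaternaryLCD.largestMinWeight F (21 * s + t) 3)
        = (QuaternaryLCD.sTable t : ℚ) ∧
    Nonempty
      (QuaternaryLCD.LCDClasses F (4 * QuaternaryLCD.rTable t) 3 (3 * QuaternaryLCD.rTable t) ≃
        QuaternaryLCD.LCDClasses F (21 * s + t) 3
          (QuaternaryLCD.largestMinWeight F (21 * s + t) 3)) := by
  have : Finite F := Nat.finite_of_card_ne_zero (by omega)
  obtain ⟨d, hd, hatt⟩ := QuaternaryLCD.exists_attains hF t s hs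
  -- the relations between the rows of the table
  have htab : 16 * (t : ℤ) - 21 * QuaternaryLCD.alphaTable t = QuaternaryLCD.rTable t ∧
      4 * QuaternaryLCD.rTable t + 21 = 21 * QuaternaryLCD.sTable t + (t : ℕ) ∧
      QuaternaryLCD.rTable t ≤ 37 ∧ QuaternaryLCD.rTable t ≠ 36 ∧ 0 < QuaternaryLCD.rTable t ∧
      -1 ≤ QuaternaryLCD.alphaTable t ∧ 1 ≤ QuaternaryLCD.sTable t := by
    clear hs hd hatt
    revert t
    decide
  obtain ⟨h1, h2, h3, h4, h5, h6, h7⟩ := htab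
  have hmax := QuaternaryLCD.largestMinWeight_eq hF (by omega) hatt (by omega) (by omega)
  rw [hmax]
  have hr : QuaternaryLCD.rParam (21 * s + t) 3 d = (QuaternaryLCD.rTable t : ℤ) := by
    rw [QuaternaryLCD.rParam]
    norm_num
    linarith
  refine ⟨hd, hr, ?_, ?_⟩
  · have hmod : (21 * s + (t : ℕ)) % ((4 ^ 3 - 1) / 3) = t := by
      have := t.isLt
      rw [show (4 ^ 3 - 1) / 3 = 21 from rfl]
      omega
    have h2' : (4 * QuaternaryLCD.rTable t + 21 : ℚ) = 21 * QuaternaryLCD.sTable t + (t : ℕ) := by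
      exact_mod_cast h2
    rw [QuaternaryLCD.sParam, hr, hmod]
    norm_num
    linarith
  · obtain ⟨k, rfl⟩ := Nat.exists_eq_add_of_le hs
    have e1 : 21 * (QuaternaryLCD.sTable t + k) + (t : ℕ)
        = 4 * QuaternaryLCD.rTable t + 21 * (k + 1) := by omega
    have e2 : d = 3 * QuaternaryLCD.rTable t + 16 * (k + 1) := by omega
    rw [e1, e2]
    exact QuaternaryLCD.nonempty_lcdClasses_equiv hF (k + 1) (by omega) (by omega)
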